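/- Let $c\ge \frac32$ be a real number. A representation of the Neveu--Schwarz algebra with central charge $c$ is a complex vector superspace $V=V_{\overline 0}\oplus V_{\overline 1}$ with even operators $L_m$ ($m\in\mathbb Z$) and odd operators $G_r$ ($r\in\mathbb Z+\frac12$) on $V$ such that $$L_mL_n-L_nL_m=(m-n)L_{m+n}+\frac{c(m^3-m)}{12}\delta_{m,-n},$$ $$L_mG_r-G_rL_m=\Big(\frac m2-r\Big)G_{m+r},$$ $$G_rG_s+G_sG_r=2L_{r+s}+\frac c3\Big(r^2-\frac14\Big)\delta_{r,-s}.$$ It is a lowest weight representation of lowest weight $h$ if there is a vector $\Omega\neq0$ with $L_0\Omega=h\Omega$ and $L_m\Omega=G_r\Omega=0$ for all $m,r>0$, such that the only subspace of $V$ which contains $\Omega$ and is invariant under all $L_m$ and $G_r$ is $V$ itself. It is irreducible if $V\neq 0$ and the only $\mathbb Z/2$-graded invariant subspaces are $0$ and $V$. It is unitary if there is a scalar product $(\cdot|\cdot)$ on $V$ (positive definite and Hermitian) such that $(L_mx|y)=(x|L_{-m}y)$ and $(G_rx|y)=(x|G_{-r}y)$ for all $x,y\in V$, $m\in\mathbb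 Z$ and $r\in\mathbb Z+\frac12$. Then every irreducible lowest weight representation of the Neveu--Schwarz algebra with central charge $c$ and lowest weight $h=0$ is unitary. -/

import Mathlib

/-- A representation of the Neveu–Schwarz algebra with central charge `c` on a complex vector
superspace `V = V_0 ⊕ V_1`: operators `L_m` (`m ∈ ℤ`), even, and `G_n` (`n ∈ ℤ + 1/2`), odd,
satisfying the Neveu–Schwarz (anti)commutation relations.
The half-integers are parametrised by the integers: `G k` is the operator `G_{k + 1/2}`. -/
structure NSRepresentation (c : ℂ) (V : Type*) [AddCommGroup V] [Module ℂ V] where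
  /-- the even part `parity 0` and the odd part `parity 1` of the superspace `V` -/
  parity : ZMod 2 → Submodule ℂ V
  isInternal : DirectSum.IsInternal parity
  /-- `L m` is the operator `L_m` -/
  L : ℤ → Module.End ℂ V
  /-- `G k` is the operator `G_{k + 1/2}` -/
  G : ℤ → Module.End ℂ V
  L_even : ∀ (m : ℤ) (p : ZMod 2), ∀ v ∈ parity p, L m v ∈ parity p
  G_odd : ∀ (k : ℤ) (p : ZMod 2), ∀ v ∈ parity p, G k v ∈ parity (p + 1)
  /-- `[L_m, L_n] = (m - n) L_{m+n} + c (m³ - m) / 12 δ_{m,-n}` -/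
  L_comm_L : ∀ m n : ℤ,
    L m * L n - L n * L m = ((m : ℂ) - n) • L (m + n) +
      (if m = -n then c * ((m : ℂ) ^ 3 - m) / 12 else 0) • (1 : Module.End ℂ V)
  /-- `[L_m, G_n] = (m/2 - n) G_{m+n}` with `n = k + 1/2` -/
  L_comm_G : ∀ m k : ℤ,
    L m * G k - G k * L m = ((m : ℂ) / 2 - ((k : ℂ) + 1 / 2)) • G (m + k)
  /-- `[G_m, G_n] = 2 L_{m+n} + c/3 (m² - 1/4) δ_{m,-n}` (an anticommutator) with
  `m = j + 1/2` and `n = k + 1/2`, so that `m + n = j + k + 1` -/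
  G_anticomm_G : ∀ j k : ℤ,
    G j * G k + G k * G j = (2 : ℂ) • L (j + k + 1) +
      (if j + k + 1 = 0 then c / 3 * (((j : ℂ) + 1 / 2) ^ 2 - 1 / 4) else 0) •
        (1 : Module.End ℂ V)

namespace NSRepresentation

variable {c : ℂ} {V : Type*} [AddCommGroup V] [Module ℂ V]

/-- A subspace that is mapped into itself by all the operators `L_m` and `G_n`. -/
def IsInvariant (ρ : NSRepresentation c V) (W : Submodule ℂ V) : Prop :=
  (∀ m : ℤ, ∀ w ∈ W, ρ.L m w ∈ W) ∧ (∀ k : ℤ, ∀ w ∈ W, ρ.G k w ∈ W)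

/-- A subsuperspace: a subspace `W` with `W = (W ∩ V_0) ⊕ (W ∩ V_1)`. -/
def IsGraded (ρ : NSRepresentation c V) (W : Submodule ℂ V) : Prop :=
  W = (W ⊓ ρ.parity 0) ⊔ (W ⊓ ρ.parity 1)

/-- The representation is nonzero and has no invariant subsuperspace other than `0` and `V`. -/
def IsIrreducible (ρ : NSRepresentation c V) : Prop :=
  Nontrivial V ∧ ∀ W : Submodule ℂ V, ρ.IsInvariant W → ρ.IsGraded W → W = ⊥ ∨ W = ⊤

/-- `Ω` is a lowest weight vector of lowest weight `h`: `Ω ≠ 0`, `L_0 Ω = h Ω`, and `L_m Ω = 0`,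
`G_n Ω = 0` for all `m, n > 0` (note that `k + 1/2 > 0` iff `k ≥ 0`). -/
def IsLowestWeightVector (ρ : NSRepresentation c V) (h : ℂ) (Ω : V) : Prop :=
  Ω ≠ 0 ∧ ρ.L 0 Ω = h • Ω ∧ (∀ m : ℤ, 0 < m → ρ.L m Ω = 0) ∧ (∀ k : ℤ, 0 ≤ k → ρ.G k Ω = 0)

/-- The smallest invariant subspace containing `Ω` is the whole space. -/
def IsCyclicVector (ρ : NSRepresentation c V) (Ω : V) : Prop :=
  ∀ W : Submodule ℂ V, ρ.IsInvariant W → Ω ∈ W → W = ⊤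

/-- A lowest weight representation of lowest weight `h`: one that is generated by a lowest weight
vector of lowest weight `h`. -/
def IsLowestWeight (ρ : NSRepresentation c V) (h : ℂ) : Prop :=
  ∃ Ω : V, ρ.IsLowestWeightVector h Ω ∧ ρ.IsCyclicVector Ω

/-- Unitarity: there is a scalar product (a positive definite Hermitian form, linear in the second
variable) on `V` with `L_m† = L_{-m}` and `G_n† = G_{-n}`; for `n = k + 1/2` one has
`-n = (-k - 1) + 1/2`. -/
def IsUnitary (ρ : NSRepresentation c V) : Prop :=
  ∃ B : InnerProductSpace.Core ℂ V,
    (∀ (m : ℤ) (x y : V), B.inner (ρ.L m x) y = B.inner x (ρ.L (-m) y)) ∧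
    (∀ (k : ℤ) (x y : V), B.inner (ρ.G k x) y = B.inner x (ρ.G (-k - 1) y))

end NSRepresentation

/-! The Fock space of one free boson and one free fermion carries a unitary representation with `c =
3/2`, with odd modes `∑ a_n ψ_{k-n}`. Adding a derivative of the fermion to the odd field raises the
central charge to `3/2 + 3κ²`. If that term respects the adjoint relations, however, the vacuum
acquires the weight `κ²/8` instead of `0`. The remedy is to let the added term be singular at the
point `-1` of the circle. Only the modes multiplied by `1 + z`, namely `G_k + G_{k+1}`, and by `(1 +
z)²`, namely `L_n + 2L_{n+1} + L_{n+2}`, then act on the Fock space. These operators `H` and `T`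
satisfy all relations which the Neveu–Schwarz relations impose on such combinations (`H_anticomm_H`,
`T_comm_H`), have the right adjoints (`inner_H`), and annihilate the vacuum as they should
(`H_vac`).

The Fock space is thus not a representation, but it suffices as a source of positivity. On the given
`V` there is a functional `ω` projecting onto `Ω` along the positive weights, and irreducibility
forces `G_{-1/2} Ω = 0`. In `V × Fock` the pair of vacua generates a subspace under the combined
modes. It projects onto `V` (`graph_surjective`), and scalar products of Fock components depend only
on the `V` component of one argument (`graph_inner_eq`); so it is the graph of a map `Φ : V → Fock`
(`exists_intertwiner`).

The form pulled back along `Φ` is nonnegative and has the adjoint relations for the combined modes.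
Those for the single modes follow from the vacuum upwards (`inner_G_and_L`). The kernel of `Φ` is
then an invariant subspace annihilated by `ω`, hence zero, and the form is definite. -/

namespace FreeFock

open scoped ComplexConjugate InnerProductSpace

/-! ### The Fock space and its scalar product. -/

/-- Labels of the orthonormal basis of the Fock space of one free boson and one free fermion:
occupation numbers of the bosonic modes, and the set of occupied fermionic modes. -/
abbrev Label := (ℕ →₀ ℕ) × Finset ℕ

/-- The algebraic Fock space of one free boson and one free fermion. -/
def Fock := Label →₀ ℂ

noncomputable section

instance : AddCommGroup Fock := inferInstanceAs (AddCommGroup (Label →₀ ℂ))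
instance : Module ℂ Fock := inferInstanceAs (Module ℂ (Label →₀ ℂ))

/-- The basis vector with the given label. -/
def basisVec (i : Label) : Fock := Finsupp.single i 1

theorem single_eq (i : Label) (z : ℂ) : (Finsupp.single i z : Label →₀ ℂ) = z • basisVec i := by
  change _ = z • (Finsupp.single i (1 : ℂ))
  simp

@[elab_as_elim]
theorem Fock.induction {p : Fock → Prop} (x : Fock) (zero : p 0)
    (add : ∀ x y, p x → p y → p (x + y)) (basis : ∀ (z : ℂ) i, p (z • basisVec i)) : p x :=
  Finsupp.induction_linear x zero add fun i z => by rw [single_eq]; exact basis z i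

/-- The coefficients of a vector. -/
def coeffs (x : Fock) : Label →₀ ℂ := x

/-- The form for which the basis vectors are orthonormal. -/
def form : Fock →ₗ⋆[ℂ] Fock →ₗ[ℂ] ℂ :=
  LinearMap.mk₂'ₛₗ (starRingEnd ℂ) (RingHom.id ℂ)
    (fun x y => (coeffs x).sum fun i z => conj z * coeffs y i)
    (fun _ _ _ => Finsupp.sum_add_index' (by simp) (by intros; simp [add_mul]))
    (fun z x y => by
      refine (Finsupp.sum_smul_index (by simp)).trans ?_
      simp only [Finsupp.sum, smul_eq_mul, Finset.mul_sum, map_mul, mul_assoc]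
      rfl)
    (fun x y y' => by
      rw [← Finsupp.sum_add]
      exact Finsupp.sum_congr fun i _ => mul_add _ _ _)
    (fun z x y => by
      rw [RingHom.id_apply, smul_eq_mul, Finsupp.mul_sum]
      exact Finsupp.sum_congr fun i _ => mul_left_comm _ _ _)

theorem form_apply (x y : Fock) : form x y = (coeffs x).sum fun i z => conj z * coeffs y i := rfl

theorem form_basisVec (i j : Label) : form (basisVec i) (basisVec j) = if i = j then 1 else 0 := by
  refine (Finsupp.sum_single_index (h := fun l z => conj z * coeffs (basisVec j) l)
    (by simp)).trans ?_
  rw [map_one, one_mul]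
  exact Finsupp.single_apply.trans (if_congr eq_comm rfl rfl)

theorem form_conj (x y : Fock) : conj (form y x) = form x y := by
  induction x using Fock.induction with
  | zero => simp
  | add x x' hx hx' => simp [hx, hx']
  | basis z i =>
    induction y using Fock.induction with
    | zero => simp
    | add y y' hy hy' => simp only [map_add, LinearMap.add_apply, hy, hy']
    | basis w j =>
      simp only [map_smul, LinearMap.map_smulₛₗ, LinearMap.smul_apply, form_basisVec, smul_eq_mul,
        map_mul, Complex.conj_conj]
      split_ifs with h1 h2 h2 <;> simp_all
      ring

theorem form_self (x : Fock) :
    form x x = (((coeffs x).sum fun _ z => Complex.normSq z : ℝ) : ℂ) := by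
  rw [form_apply, Finsupp.sum, Finsupp.sum, Complex.ofReal_sum]
  exact Finset.sum_congr rfl fun i _ => (Complex.normSq_eq_conj_mul_self).symm

/-- The scalar product of the Fock space. -/
@[reducible]
def core : InnerProductSpace.Core ℂ Fock where
  inner x y := form x y
  conj_inner_symm x y := form_conj x y
  re_inner_nonneg x := by
    rw [form_self]
    exact Finset.sum_nonneg fun i _ => Complex.normSq_nonneg _
  add_left x y z := by simp
  smul_left x y r := by simp
  definite x hx := by
    rw [form_self, Complex.ofReal_eq_zero, Finsupp.sum,
      Finset.sum_eq_zero_iff_of_nonneg fun i _ => Complex.normSq_nonneg _] at hx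
    refine Finsupp.ext (f := coeffs x) fun i => ?_
    by_contra h
    exact h (Complex.normSq_eq_zero.1 (hx i (Finsupp.mem_support_iff.2 h)))

instance : NormedAddCommGroup Fock := core.toNormedAddCommGroup
instance : InnerProductSpace ℂ Fock := InnerProductSpace.ofCore core.toCore

theorem inner_basisVec (i j : Label) :
    ⟪basisVec i, basisVec j⟫_ℂ = if i = j then 1 else 0 := form_basisVec i j

theorem linearMap_ext {M : Type*} [AddCommGroup M] [Module ℂ M] {f g : Fock →ₗ[ℂ] M}
    (h : ∀ i, f (basisVec i) = g (basisVec i)) : f = g := by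
  ext x
  induction x using Fock.induction with
  | zero => simp
  | add x y hx hy => simp [hx, hy]
  | basis z i => simp [h]

/-! ### Creation and annihilation operators. -/

/-- The weighted shift `e_i ↦ f i • e_{g i}`. -/
def wshift (f : Label → ℝ) (g : Label → Label) : Module.End ℂ Fock :=
  Finsupp.linearCombination ℂ fun i => (f i : ℂ) • basisVec (g i)

@[simp]
theorem wshift_basisVec (f : Label → ℝ) (g : Label → Label) (i : Label) :
    wshift f g (basisVec i) = (f i : ℂ) • basisVec (g i) := by
  rw [wshift, basisVec]
  refine (Finsupp.linearCombination_single ..).trans (one_smul _ _)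

/-- With real weights, adjointness means that two matrices in the orthonormal basis are transposes
of each other; this reduces it to a statement about labels. -/
theorem inner_wshift {f f' : Label → ℝ} {g g' : Label → Label}
    (h : ∀ i j, (if g i = j then f i else 0) = if i = g' j then f' j else 0) (x y : Fock) :
    ⟪wshift f g x, y⟫_ℂ = ⟪x, wshift f' g' y⟫_ℂ := by
  induction x using Fock.induction with
  | zero => simp
  | add x x' hx hx' => simp only [map_add, inner_add_left, hx, hx']
  | basis z i =>
    induction y using Fock.induction with
    | zero => simp
    | add y y' hy hy' => simp only [map_add, inner_add_right, hy, hy']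
    | basis w j =>
      simp only [map_smul, wshift_basisVec, inner_smul_left, inner_smul_right, inner_basisVec,
        mul_ite, mul_one, mul_zero]
      have := congrArg (fun t : ℝ => (t : ℂ)) (h i j)
      simp only [apply_ite Complex.ofReal, Complex.ofReal_zero] at this
      rw [Complex.conj_ofReal]
      split_ifs at this ⊢ <;> grind

/-- The sign picked up by a fermionic mode that is moved past the occupied modes below it. -/
def sgn (k : ℕ) (S : Finset ℕ) : ℝ := (-1) ^ (S.filter (· < k)).card

theorem sgn_mul_self (k : ℕ) (S : Finset ℕ) : sgn k S * sgn k S = 1 := by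
  rw [sgn, ← pow_add, ← two_mul, pow_mul]; simp

theorem sgn_insert_of_lt {j k : ℕ} {S : Finset ℕ} (hj : j ∉ S) (h : j < k) :
    sgn k (insert j S) = -sgn k S := by
  rw [sgn, sgn, Finset.filter_insert, if_pos h, Finset.card_insert_of_notMem (by simp [hj]),
    pow_succ]
  ring

theorem sgn_insert_of_le {j k : ℕ} {S : Finset ℕ} (h : k ≤ j) :
    sgn k (insert j S) = sgn k S := by
  rw [sgn, sgn, Finset.filter_insert, if_neg (by omega)]

theorem sgn_erase_of_lt {j k : ℕ} {S : Finset ℕ} (hj : j ∈ S) (h : j < k) :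
    sgn k (S.erase j) = -sgn k S := by
  conv_rhs => rw [← Finset.insert_erase hj, sgn_insert_of_lt (Finset.notMem_erase j S) h, neg_neg]

theorem sgn_erase_of_le {j k : ℕ} {S : Finset ℕ} (h : k ≤ j) :
    sgn k (S.erase j) = sgn k S := by
  by_cases hj : j ∈ S
  · conv_rhs => rw [← Finset.insert_erase hj, sgn_insert_of_le h]
  · rw [Finset.erase_eq_of_notMem hj]

/-- Annihilation of a boson in the mode `n + 1`. -/
def bosonAnn (n : ℕ) : Module.End ℂ Fock :=
  wshift (fun i => √((n + 1) * i.1 n)) fun i => (i.1 - Finsupp.single n 1, i.2)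

/-- Creation of a boson in the mode `n + 1`. -/
def bosonCre (n : ℕ) : Module.End ℂ Fock :=
  wshift (fun i => √((n + 1) * (i.1 n + 1))) fun i => (i.1 + Finsupp.single n 1, i.2)

/-- Annihilation of a fermion in the mode `k + 1/2`. -/
def fermionAnn (k : ℕ) : Module.End ℂ Fock :=
  wshift (fun i => if k ∈ i.2 then sgn k i.2 else 0) fun i => (i.1, i.2.erase k)

/-- Creation of a fermion in the mode `k + 1/2`. -/
def fermionCre (k : ℕ) : Module.End ℂ Fock :=
  wshift (fun i => if k ∈ i.2 then 0 else sgn k i.2) fun i => (i.1, insert k i.2)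

/-- The modes `a_n` of the free boson, with `a_0 = 0`. -/
def a : ℤ → Module.End ℂ Fock
  | .ofNat 0 => 0
  | .ofNat (n + 1) => bosonAnn n
  | .negSucc n => bosonCre n

/-- The modes of the free fermion; `ψ k` is the mode `k + 1/2`. -/
def ψ : ℤ → Module.End ℂ Fock
  | .ofNat k => fermionAnn k
  | .negSucc k => fermionCre k

/-- The vacuum vector. -/
def vac : Fock := basisVec (0, ∅)

/-! ### Adjoints and canonical (anti)commutation relations. -/

theorem inner_bosonAnn (n : ℕ) (x y : Fock) :
    ⟪bosonAnn n x, y⟫_ℂ = ⟪x, bosonCre n y⟫_ℂ := by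
  refine inner_wshift (fun i j => ?_) x y
  obtain ⟨α, S⟩ := i
  obtain ⟨β, T⟩ := j
  simp only [Prod.mk.injEq]
  -- Truncated subtraction fixes the label of an empty mode, but there the weight is `√0`.
  by_cases hn : α n = 0
  · have : α ≠ β + Finsupp.single n 1 := by
      rintro rfl; simp at hn
    simp [hn, this]
  · have : α - Finsupp.single n 1 = β ↔ α = β + Finsupp.single n 1 := by
      have hle : Finsupp.single n 1 ≤ α := by
        rw [Finsupp.single_le_iff]; omega
      exact tsub_eq_iff_eq_add_of_le hle
    simp only [this]
    split_ifs with h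
    · rw [h.1]; simp
    · rfl

theorem inner_fermionAnn (k : ℕ) (x y : Fock) :
    ⟪fermionAnn k x, y⟫_ℂ = ⟪x, fermionCre k y⟫_ℂ := by
  refine inner_wshift (fun i j => ?_) x y
  obtain ⟨α, S⟩ := i
  obtain ⟨β, T⟩ := j
  simp only [Prod.mk.injEq]
  by_cases hk : k ∈ S
  · by_cases hk' : k ∈ T
    · have : S.erase k ≠ T := by rintro rfl; simp at hk'
      simp [this, hk']
    · have : S.erase k = T ↔ S = insert k T := by
        constructor
        · rintro rfl; exact (Finset.insert_erase hk).symm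
        · rintro rfl; exact Finset.erase_insert hk'
      simp only [this, if_pos hk, if_neg hk']
      split_ifs with h
      · rw [h.2, sgn_insert_of_le le_rfl]
      · rfl
  · have : S ≠ insert k T := by rintro rfl; simp at hk
    simp [hk, this]

theorem inner_a (n : ℤ) (x y : Fock) : ⟪a n x, y⟫_ℂ = ⟪x, a (-n) y⟫_ℂ := by
  match n with
  | .ofNat 0 => simp [a]
  | .ofNat (n + 1) => exact inner_bosonAnn n x y
  | .negSucc n =>
    rw [← inner_conj_symm, ← inner_conj_symm x]
    exact congrArg _ (inner_bosonAnn n y x).symm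

theorem inner_ψ (k : ℤ) (x y : Fock) : ⟪ψ k x, y⟫_ℂ = ⟪x, ψ (-k - 1) y⟫_ℂ := by
  match k with
  | .ofNat k =>
    have : -(Int.ofNat k) - 1 = Int.negSucc k := by simp [Int.negSucc_eq]; ring
    rw [this]
    exact inner_fermionAnn k x y
  | .negSucc k =>
    have : -(Int.negSucc k) - 1 = Int.ofNat k := by simp [Int.negSucc_eq]
    rw [this, ← inner_conj_symm, ← inner_conj_symm x]
    exact congrArg _ (inner_fermionAnn k y x).symm

theorem bosonAnn_comm_bosonCre (m n : ℕ) :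
    bosonAnn m * bosonCre n - bosonCre n * bosonAnn m = if m = n then ((m : ℂ) + 1) • 1 else 0 := by
  refine linearMap_ext fun i => ?_
  obtain ⟨α, S⟩ := i
  simp only [LinearMap.sub_apply, Module.End.mul_apply, bosonAnn, bosonCre, wshift_basisVec,
    map_smul, smul_smul, ← Complex.ofReal_mul]
  by_cases h : m = n
  · subst h
    have h2 : √(((m : ℝ) + 1) * (α m + 1)) * √((m + 1) * ((α + Finsupp.single m 1 : ℕ →₀ ℕ) m : ℕ)) =
        (m + 1) * (α m + 1) := by
      simp only [Finsupp.add_apply, Finsupp.single_eq_same, Nat.cast_add, Nat.cast_one]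
      exact Real.mul_self_sqrt (by positivity)
    rw [h2, add_tsub_cancel_right]
    by_cases hm : α m = 0
    · simp [hm]
    · have hle : Finsupp.single m 1 ≤ α := by
        rw [Finsupp.single_le_iff]; omega
      have h1 : √(((m : ℝ) + 1) * α m) * √((m + 1) * (((α - Finsupp.single m 1 : ℕ →₀ ℕ) m : ℕ) + 1)) =
          (m + 1) * α m := by
        have : (((α - Finsupp.single m 1 : ℕ →₀ ℕ) m : ℕ) : ℝ) + 1 = α m := by
          rw [Finsupp.tsub_apply, Finsupp.single_eq_same, Nat.cast_sub (by omega)]; simp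
        rw [this]
        exact Real.mul_self_sqrt (by positivity)
      rw [h1, tsub_add_cancel_of_le hle, ← sub_smul, if_pos rfl]
      simp only [LinearMap.smul_apply, Module.End.one_apply]
      congr 1
      push_cast
      ring
  · have e : α + Finsupp.single n 1 - Finsupp.single m 1 =
        α - Finsupp.single m 1 + Finsupp.single n 1 := by
      ext t
      simp only [Finsupp.tsub_apply, Finsupp.add_apply, Finsupp.single_apply]
      split_ifs <;> omega
    rw [e, if_neg h, LinearMap.zero_apply, ← sub_smul]
    simp [h, Ne.symm h, mul_comm]

theorem bosonAnn_comm (m n : ℕ) : bosonAnn m * bosonAnn n = bosonAnn n * bosonAnn m := by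
  rcases eq_or_ne m n with rfl | h
  · rfl
  refine linearMap_ext fun i => ?_
  obtain ⟨α, S⟩ := i
  simp only [Module.End.mul_apply, bosonAnn, wshift_basisVec, map_smul, smul_smul,
    ← Complex.ofReal_mul, Finsupp.tsub_apply, Finsupp.single_apply, h, h.symm, if_false, Nat.sub_zero]
  rw [mul_comm, tsub_right_comm]

theorem bosonCre_comm (m n : ℕ) : bosonCre m * bosonCre n = bosonCre n * bosonCre m := by
  rcases eq_or_ne m n with rfl | h
  · rfl
  refine linearMap_ext fun i => ?_
  obtain ⟨α, S⟩ := i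
  simp only [Module.End.mul_apply, bosonCre, wshift_basisVec, map_smul, smul_smul,
    ← Complex.ofReal_mul, Finsupp.add_apply, Finsupp.single_apply, h, h.symm, if_false, Nat.add_zero]
  rw [mul_comm, add_right_comm]

/-- The canonical commutation relations. -/
theorem a_comm_a (m n : ℤ) :
    a m * a n - a n * a m = if m + n = 0 then (m : ℂ) • (1 : Module.End ℂ Fock) else 0 := by
  match m, n with
  | .ofNat 0, n => simp [a]
  | .ofNat (m + 1), .ofNat 0 =>
    rw [if_neg (by simp only [Int.ofNat_eq_natCast]; omega)]
    simp [a]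
  | .negSucc m, .ofNat 0 =>
    rw [if_neg (by simp only [Int.ofNat_eq_natCast]; omega)]
    simp [a]
  | .ofNat (m + 1), .ofNat (n + 1) =>
    rw [if_neg (by simp only [Int.ofNat_eq_natCast]; omega)]
    exact sub_eq_zero.2 (bosonAnn_comm m n)
  | .negSucc m, .negSucc n =>
    rw [if_neg (by omega)]
    exact sub_eq_zero.2 (bosonCre_comm m n)
  | .ofNat (m + 1), .negSucc n =>
    refine (bosonAnn_comm_bosonCre m n).trans ?_
    refine if_congr (by simp only [Int.ofNat_eq_natCast]; omega) (by simp) rfl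
  | .negSucc m, .ofNat (n + 1) =>
    rw [← neg_sub]
    refine (congrArg Neg.neg (bosonAnn_comm_bosonCre n m)).trans ?_
    rw [apply_ite Neg.neg, neg_zero]
    split_ifs with h1 h2 h2
    · subst h1
      simp [Int.negSucc_eq]
      rw [← neg_smul, neg_add, add_comm]
    · simp only [Int.ofNat_eq_natCast] at h2; omega
    · simp only [Int.ofNat_eq_natCast] at h2; omega
    · rfl

theorem fermionAnn_anticomm (j k : ℕ) :
    fermionAnn j * fermionAnn k + fermionAnn k * fermionAnn j = 0 := by
  refine linearMap_ext fun i => ?_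
  obtain ⟨α, S⟩ := i
  wlog h : j ≤ k generalizing j k
  · rw [add_comm]; exact this k j (by omega)
  rcases h.eq_or_lt with rfl | h
  · by_cases hj : j ∈ S <;> simp [fermionAnn, hj]
  simp only [LinearMap.add_apply, Module.End.mul_apply, fermionAnn, wshift_basisVec, map_smul,
    smul_smul, ← Complex.ofReal_mul, Finset.mem_erase, h.ne, h.ne', ne_eq, not_false_eq_true,
    true_and]
  -- Removing the lower mode `j` flips the sign attached to `k`, while removing `k` does not affect
  -- the sign attached to `j`; hence the two orders cancel.
  rw [Finset.erase_right_comm, ← add_smul, ← Complex.ofReal_add, sgn_erase_of_le h.le]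
  by_cases hj : j ∈ S
  · rw [sgn_erase_of_lt hj h]
    simp [hj]
    split_ifs <;> simp [mul_comm]
  · simp [hj]

theorem fermionCre_anticomm (j k : ℕ) :
    fermionCre j * fermionCre k + fermionCre k * fermionCre j = 0 := by
  refine linearMap_ext fun i => ?_
  obtain ⟨α, S⟩ := i
  wlog h : j ≤ k generalizing j k
  · rw [add_comm]; exact this k j (by omega)
  rcases h.eq_or_lt with rfl | h
  · by_cases hj : j ∈ S <;> simp [fermionCre, hj]
  simp only [LinearMap.add_apply, Module.End.mul_apply, fermionCre, wshift_basisVec, map_smul,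
    smul_smul, ← Complex.ofReal_mul, Finset.mem_insert, h.ne, h.ne', false_or]
  rw [Finset.insert_comm, ← add_smul, ← Complex.ofReal_add, sgn_insert_of_le h.le]
  by_cases hj : j ∈ S
  · simp [hj]
  · rw [sgn_insert_of_lt hj h]
    simp [hj]
    split_ifs <;> simp [mul_comm]

theorem fermionAnn_anticomm_fermionCre (j k : ℕ) :
    fermionAnn j * fermionCre k + fermionCre k * fermionAnn j = if j = k then 1 else 0 := by
  refine linearMap_ext fun i => ?_
  obtain ⟨α, S⟩ := i
  simp only [LinearMap.add_apply, Module.End.mul_apply, fermionAnn, fermionCre, wshift_basisVec,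
    map_smul, smul_smul, ← Complex.ofReal_mul, Finset.mem_erase, Finset.mem_insert]
  rcases eq_or_ne j k with rfl | h
  · by_cases hj : j ∈ S
    · simp [hj, sgn_erase_of_le, sgn_mul_self, Finset.insert_erase]
    · simp [hj, sgn_insert_of_le, sgn_mul_self]
  · simp only [h, h.symm, ne_eq, not_false_eq_true, true_and, false_or, if_false,
      LinearMap.zero_apply]
    rw [Finset.erase_insert_of_ne h.symm, ← add_smul, ← Complex.ofReal_add]
    by_cases hj : j ∈ S <;> by_cases hk : k ∈ S <;> simp only [hj, hk, if_true, if_false, mul_zero,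
      zero_mul, add_zero, Complex.ofReal_zero, zero_smul]
    rcases lt_or_gt_of_ne h with h | h
    · rw [sgn_erase_of_lt hj h, sgn_insert_of_le h.le]
      simp [mul_comm]
    · rw [sgn_erase_of_le h.le, sgn_insert_of_lt hk h]
      simp [mul_comm]

/-- The canonical anticommutation relations. -/
theorem ψ_anticomm_ψ (j k : ℤ) :
    ψ j * ψ k + ψ k * ψ j = if j + k + 1 = 0 then (1 : Module.End ℂ Fock) else 0 := by
  match j, k with
  | .ofNat j, .ofNat k =>
    rw [if_neg (by simp only [Int.ofNat_eq_natCast]; omega)]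
    exact fermionAnn_anticomm j k
  | .negSucc j, .negSucc k =>
    rw [if_neg (by omega)]
    exact fermionCre_anticomm j k
  | .ofNat j, .negSucc k =>
    refine (fermionAnn_anticomm_fermionCre j k).trans ?_
    exact if_congr (by simp only [Int.ofNat_eq_natCast]; omega) rfl rfl
  | .negSucc j, .ofNat k =>
    rw [add_comm]
    refine (fermionAnn_anticomm_fermionCre k j).trans ?_
    exact if_congr (by simp only [Int.ofNat_eq_natCast]; omega) rfl rfl

theorem a_comm_ψ (n k : ℤ) : a n * ψ k = ψ k * a n := by
  match n, k with
  | .ofNat 0, k => simp [a]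
  | .ofNat (n + 1), .ofNat k | .ofNat (n + 1), .negSucc k | .negSucc n, .ofNat k
  | .negSucc n, .negSucc k =>
    refine linearMap_ext fun i => ?_
    simp only [a, ψ, Module.End.mul_apply, bosonAnn, bosonCre, fermionAnn, fermionCre,
      wshift_basisVec, map_smul, smul_smul]
    rw [mul_comm]

/-! ### The vacuum of the free fields. -/

theorem a_vac {n : ℤ} (hn : 0 ≤ n) : a n vac = 0 := by
  match n with
  | .ofNat 0 => simp [a]
  | .ofNat (n + 1) => simp [a, bosonAnn, vac]
  | .negSucc n => omega

theorem ψ_vac {k : ℤ} (hk : 0 ≤ k) : ψ k vac = 0 := by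
  match k with
  | .ofNat k => simp [ψ, fermionAnn, vac]
  | .negSucc k => omega

theorem inner_vac_vac : ⟪vac, vac⟫_ℂ = 1 := by
  rw [vac, inner_basisVec, if_pos rfl]

/-- The vacuum vector is cyclic for the free fields. -/
theorem eq_top_of_vac_mem {W : Submodule ℂ Fock} (hvac : vac ∈ W)
    (ha : ∀ n < 0, ∀ x ∈ W, a n x ∈ W) (hψ : ∀ k < 0, ∀ x ∈ W, ψ k x ∈ W) : W = ⊤ := by
  have key : ∀ α β : ℕ →₀ ℕ, basisVec (β, ∅) ∈ W → basisVec (β + α, ∅) ∈ W := by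
    intro α
    induction α using Finsupp.induction_linear with
    | zero => simp
    | add f g hf hg =>
      intro β hβ
      rw [← add_assoc]
      exact hg _ (hf _ hβ)
    | single n b =>
      induction b with
      | zero => simp
      | succ b ih =>
        intro β hβ
        have := ha (.negSucc n) (Int.negSucc_lt_zero n) _ (ih β hβ)
        simp only [a, bosonCre, wshift_basisVec] at this
        rw [Submodule.smul_mem_iff, add_assoc, ← Finsupp.single_add] at this
        · exact this
        · exact Complex.ofReal_ne_zero.2 (Real.sqrt_pos.2 (by positivity)).ne'
  have key2 : ∀ (S : Finset ℕ) (α : ℕ →₀ ℕ), basisVec (α, S) ∈ W := by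
    intro S α
    induction S using Finset.induction_on with
    | empty => simpa using key α 0 hvac
    | insert k S hk ih =>
      have := hψ (.negSucc k) (Int.negSucc_lt_zero k) _ ih
      simp only [ψ, fermionCre, wshift_basisVec, if_neg hk] at this
      rwa [Submodule.smul_mem_iff] at this
      refine Complex.ofReal_ne_zero.2 fun h => ?_
      simpa [h] using sgn_mul_self k S
  rw [eq_top_iff]
  rintro x -
  induction x using Fock.induction with
  | zero => exact W.zero_mem
  | add x y hx hy => exact W.add_mem hx hy
  | basis z i => exact W.smul_mem _ (key2 i.2 i.1)

/-- A vector is annihilated by all modes of sufficiently high degree. -/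
theorem exists_annihilated (x : Fock) : ∃ N : ℤ, ∀ n, N ≤ n → a n x = 0 ∧ ψ n x = 0 := by
  induction x using Fock.induction with
  | zero => exact ⟨0, by simp⟩
  | add x y hx hy =>
    obtain ⟨N, hN⟩ := hx
    obtain ⟨M, hM⟩ := hy
    refine ⟨max N M, fun n hn => ?_⟩
    have h1 := hN n ((le_max_left _ _).trans hn)
    have h2 := hM n ((le_max_right _ _).trans hn)
    simp [h1, h2]
  | basis z i =>
    obtain ⟨α, S⟩ := i
    refine ⟨((α.support ∪ S).sup id : ℕ) + 2, fun n hn => ?_⟩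
    match n with
    | .ofNat 0 => simp only [Int.ofNat_eq_natCast] at hn; omega
    | .negSucc n => omega
    | .ofNat (n + 1) =>
      simp only [Int.ofNat_eq_natCast] at hn
      have h1 : α n = 0 := by
        by_contra h
        have := Finset.le_sup (f := id) (show n ∈ α.support ∪ S by simp [h])
        simp only [id] at this
        omega
      have h2 : n + 1 ∉ S := by
        intro h
        have := Finset.le_sup (f := id) (show n + 1 ∈ α.support ∪ S by simp [h])
        simp only [id] at this
        omega
      simp [a, ψ, bosonAnn, fermionAnn, h1, h2]

end

end FreeFock

/-! ### Central terms and relations of the modes multiplied by powers of `1 + z`. -/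

namespace NeveuSchwarz

/-- The central term of the anticommutator of `G_{j + 1/2}` and `G_{k + 1/2}`. -/
noncomputable def cocycle (c : ℂ) (j k : ℤ) : ℂ :=
  if j + k + 1 = 0 then c / 3 * (((j : ℂ) + 1 / 2) ^ 2 - 1 / 4) else 0

/-- The central term of the anticommutator of `G_{j + 1/2} + G_{j + 3/2}` and
`G_{k + 1/2} + G_{k + 3/2}`. -/
noncomputable def cocycle' (c : ℂ) (j k : ℤ) : ℂ :=
  cocycle c j k + cocycle c (j + 1) k + cocycle c j (k + 1) + cocycle c (j + 1) (k + 1)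

/-- The coefficient `r² - 1/4` vanishes at `r = ±1/2`, the two modes combined at index `-1`. This
makes the even combinations anticommutators without a central term, as in `TV_eq`. -/
theorem cocycle'_neg_one (c : ℂ) (k : ℤ) : cocycle' c (-1) k = 0 := by
  simp only [cocycle', cocycle]
  split_ifs <;> push_cast <;> ring

theorem cocycle'_zero_neg_one (c : ℂ) : cocycle' c 0 (-1) = 0 := by
  simp [cocycle', cocycle]
  norm_num

/-- The anticommutator of two fermionic modes. -/
noncomputable def delta (j k : ℤ) : ℂ := if j + k + 1 = 0 then 1 else 0

/-- The correction is the contribution of the deformation `iκ(k + 1)(ψ_k + ψ_{k+1})` to the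
anticommutator; it is what raises the central charge. -/
theorem cocycle'_add (κ : ℂ) (j k : ℤ) :
    cocycle' (3 / 2 + 3 * κ ^ 2) j k = cocycle' (3 / 2) j k -
      κ ^ 2 * (j + 1) * (k + 1) *
        (delta j k + delta (j + 1) k + delta j (k + 1) + delta (j + 1) (k + 1)) := by
  simp only [cocycle', cocycle, delta]
  by_cases h0 : j + k + 1 = 0
  · obtain rfl : k = -j - 1 := by omega
    split_ifs <;> first | omega | (push_cast; ring)
  by_cases h1 : j + k + 2 = 0
  · obtain rfl : k = -j - 2 := by omega
    split_ifs <;> first | omega | (push_cast; ring)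
  by_cases h2 : j + k + 3 = 0
  · obtain rfl : k = -j - 3 := by omega
    split_ifs <;> first | omega | (push_cast; ring)
  split_ifs <;> first | omega | ring

section Shifted

variable {M : Type*} [AddCommGroup M] [Module ℂ M] {c : ℂ} {G L : ℤ → Module.End ℂ M}

theorem shifted_anticomm
    (hGG : ∀ j k, G j * G k + G k * G j = (2 : ℂ) • L (j + k + 1) + cocycle c j k • 1) (j k : ℤ) :
    (G j + G (j + 1)) * (G k + G (k + 1)) + (G k + G (k + 1)) * (G j + G (j + 1)) =
      (2 : ℂ) • (L (j + k + 1) + (2 : ℂ) • L (j + k + 1 + 1) + L (j + k + 1 + 2)) +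
        cocycle' c j k • 1 := by
  have h0 := hGG j k
  have h1 := hGG (j + 1) k
  have h2 := hGG j (k + 1)
  have h3 := hGG (j + 1) (k + 1)
  rw [show j + 1 + k + 1 = j + k + 1 + 1 by ring] at h1
  rw [show j + (k + 1) + 1 = j + k + 1 + 1 by ring] at h2
  rw [show j + 1 + (k + 1) + 1 = j + k + 1 + 2 by ring] at h3
  rw [cocycle']
  simp only [add_mul, mul_add]
  linear_combination (norm := module) h0 + h1 + h2 + h3

/-- The bracket is `f'g/2 - fg'` on test functions. For `f = (1 + z)² p` and `g = (1 + z) q` the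
terms that differentiate `1 + z` cancel, so the coefficient is the original one and the result is
multiplied by `(1 + z)³`. -/
theorem shifted_comm
    (hLG : ∀ n k, L n * G k - G k * L n = ((n : ℂ) / 2 - (k + 1 / 2)) • G (n + k)) (n k : ℤ) :
    (L n + (2 : ℂ) • L (n + 1) + L (n + 2)) * (G k + G (k + 1)) -
      (G k + G (k + 1)) * (L n + (2 : ℂ) • L (n + 1) + L (n + 2)) =
    ((n : ℂ) / 2 - (k + 1 / 2)) • ((G (n + k) + G (n + k + 1)) +
      (2 : ℂ) • (G (n + k + 1) + G (n + k + 2)) + (G (n + k + 2) + G (n + k + 3))) := by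
  have h0 := hLG n k
  have h1 := hLG n (k + 1)
  have h2 := hLG (n + 1) k
  have h3 := hLG (n + 1) (k + 1)
  have h4 := hLG (n + 2) k
  have h5 := hLG (n + 2) (k + 1)
  rw [show n + (k + 1) = n + k + 1 by ring] at h1
  rw [show n + 1 + k = n + k + 1 by ring] at h2
  rw [show n + 1 + (k + 1) = n + k + 2 by ring] at h3
  rw [show n + 2 + k = n + k + 2 by ring] at h4
  rw [show n + 2 + (k + 1) = n + k + 3 by ring] at h5
  push_cast at h0 h1 h2 h3 h4 h5
  simp only [add_mul, mul_add, smul_mul_assoc, mul_smul_comm]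
  linear_combination (norm := module) h0 + h1 + (2 : ℂ) • h2 + (2 : ℂ) • h3 + h4 + h5

end Shifted

end NeveuSchwarz

/-! ### The free field representation with central charge `3/2`. -/

namespace FreeFock

open NeveuSchwarz
open scoped ComplexConjugate InnerProductSpace

noncomputable section

theorem ψ_anticomm_ψ' (j k : ℤ) : ψ j * ψ k + ψ k * ψ j = delta j k • 1 := by
  rw [ψ_anticomm_ψ, delta]
  split_ifs <;> simp

/-- Bosonic and fermionic modes commute, so whichever has high degree can act first; no normal
ordering is needed. -/
theorem support_finite (k : ℤ) (x : Fock) :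
    (Function.support fun n => a n (ψ (k - n) x)).Finite := by
  obtain ⟨N, hN⟩ := exists_annihilated x
  refine (Set.finite_Icc (k - N) N).subset fun n hn => ?_
  by_contra h
  refine hn ?_
  beta_reduce
  rcases lt_or_ge N n with h1 | h1
  · rw [← Module.End.mul_apply, a_comm_ψ, Module.End.mul_apply, (hN n h1.le).1, map_zero]
  · rw [(hN (k - n) (by simp only [Set.mem_Icc, not_and] at h; omega)).2, map_zero]

/-- The modes of the odd field `∑ a_n ψ_{k - n}`; `G₀ k` is the mode `k + 1/2`. -/
def G₀ (k : ℤ) : Module.End ℂ Fock where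
  toFun x := ∑ᶠ n : ℤ, a n (ψ (k - n) x)
  map_add' x y := by
    rw [← finsum_add_distrib (support_finite k x) (support_finite k y)]
    simp only [map_add]
  map_smul' z x := by
    rw [RingHom.id_apply, smul_finsum' z (support_finite k x)]
    simp only [map_smul]

theorem G₀_apply (k : ℤ) (x : Fock) : G₀ k x = ∑ᶠ n : ℤ, a n (ψ (k - n) x) := rfl

theorem map_G₀ {M : Type*} [AddCommGroup M] [Module ℂ M] (f : Fock →ₗ[ℂ] M) (k : ℤ) (x : Fock) :
    f (G₀ k x) = ∑ᶠ n : ℤ, f (a n (ψ (k - n) x)) :=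
  f.toAddMonoidHom.map_finsum (support_finite k x)

theorem support_map_finite {M : Type*} [AddCommGroup M] [Module ℂ M] (f : Fock →ₗ[ℂ] M) (k : ℤ)
    (x : Fock) : (Function.support fun n => f (a n (ψ (k - n) x))).Finite :=
  (support_finite k x).subset fun n hn h => hn (by simp only [h, map_zero])

/-- Supersymmetry exchanges the two free fields. This relation and `a_comm_G₀` determine the
brackets of all composite operators with the free fields. -/
theorem G₀_anticomm_ψ (k s : ℤ) : G₀ k * ψ s + ψ s * G₀ k = a (k + s + 1) := by
  ext x
  rw [LinearMap.add_apply, Module.End.mul_apply, Module.End.mul_apply, map_G₀, G₀_apply,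
    ← finsum_add_distrib (support_finite _ _) (support_map_finite _ _ _)]
  have h (n : ℤ) : a n (ψ (k - n) (ψ s x)) + ψ s (a n (ψ (k - n) x)) =
      delta (k - n) s • a n x := by
    have h1 := congrArg (fun f : Module.End ℂ Fock => f (ψ (k - n) x)) (a_comm_ψ n s)
    have h2 := congrArg (fun f : Module.End ℂ Fock => a n (f x)) (ψ_anticomm_ψ' (k - n) s)
    simp only [Module.End.mul_apply, LinearMap.add_apply, LinearMap.smul_apply,
      Module.End.one_apply, map_add, map_smul] at h1 h2
    rw [← h1, h2]
  simp only [h]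
  rw [finsum_eq_single _ (k + s + 1)]
  · rw [delta, if_pos (by ring), one_smul]
  · intro n hn
    rw [delta, if_neg (by omega), zero_smul]

theorem a_comm_G₀ (m k : ℤ) : a m * G₀ k - G₀ k * a m = (m : ℂ) • ψ (k + m) := by
  ext x
  rw [LinearMap.sub_apply, Module.End.mul_apply, Module.End.mul_apply, map_G₀, G₀_apply,
    ← finsum_sub_distrib (support_map_finite _ _ _) (support_finite _ _)]
  have h (n : ℤ) : a m (a n (ψ (k - n) x)) - a n (ψ (k - n) (a m x)) =
      (if m + n = 0 then (m : ℂ) else 0) • ψ (k - n) x := by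
    have h1 := congrArg (fun f : Module.End ℂ Fock => a n (f x)) (a_comm_ψ m (k - n))
    have h2 := congrArg (fun f : Module.End ℂ Fock => f (ψ (k - n) x)) (a_comm_a m n)
    simp only [Module.End.mul_apply, LinearMap.sub_apply] at h1 h2
    rw [← h1, h2]
    split_ifs <;> simp
  simp only [h]
  rw [finsum_eq_single _ (-m)]
  · rw [if_pos (by ring), sub_neg_eq_add, LinearMap.smul_apply]
  · intro n hn
    rw [if_neg (by omega), zero_smul]

theorem G₀_vac_eq_sum (k : ℤ) :
    G₀ k vac = ∑ n ∈ Finset.Icc (k + 1) (-1), a n (ψ (k - n) vac) := by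
  rw [G₀_apply]
  refine finsum_eq_sum_of_support_subset _ fun n hn => ?_
  by_contra h
  refine hn ?_
  beta_reduce
  rw [Finset.coe_Icc, Set.mem_Icc] at h
  rcases le_or_gt 0 n with h1 | h1
  · rw [← Module.End.mul_apply, a_comm_ψ, Module.End.mul_apply, a_vac h1, map_zero]
  · rw [ψ_vac (show 0 ≤ k - n by omega), map_zero]

theorem G₀_vac {k : ℤ} (hk : -1 ≤ k) : G₀ k vac = 0 := by
  rw [G₀_vac_eq_sum, Finset.Icc_eq_empty (by omega), Finset.sum_empty]

theorem inner_G₀ (k : ℤ) (x y : Fock) : ⟪G₀ k x, y⟫_ℂ = ⟪x, G₀ (-k - 1) y⟫_ℂ := by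
  rw [← inner_conj_symm]
  have h1 := map_G₀ (innerₛₗ ℂ y) k x
  have h2 := map_G₀ (innerₛₗ ℂ x) (-k - 1) y
  simp only [innerₛₗ_apply_apply] at h1 h2
  rw [h1, h2]
  have h3 := support_map_finite (innerₛₗ ℂ y) k x
  simp only [innerₛₗ_apply_apply] at h3
  refine ((starRingEnd ℂ).toAddMonoidHom.map_finsum h3).trans ?_
  rw [← finsum_comp_equiv (Equiv.neg ℤ)]
  refine finsum_congr fun n => ?_
  simp only [Equiv.neg_apply]
  change conj _ = _
  rw [inner_conj_symm, inner_a, inner_ψ, neg_neg, ← Module.End.mul_apply, ← a_comm_ψ,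
    Module.End.mul_apply]
  congr 4
  ring_nf

/-- A vector that is annihilated by all annihilation operators is a multiple of the vacuum. -/
theorem eq_smul_vac {x : Fock} (ha : ∀ n, 0 ≤ n → a n x = 0) (hψ : ∀ k, 0 ≤ k → ψ k x = 0) :
    x = ⟪vac, x⟫_ℂ • vac := by
  set z := x - ⟪vac, x⟫_ℂ • vac with hz
  have hza (n : ℤ) (hn : 0 ≤ n) : a n z = 0 := by simp [hz, ha n hn, a_vac hn]
  have hzψ (n : ℤ) (hn : 0 ≤ n) : ψ n z = 0 := by simp [hz, hψ n hn, ψ_vac hn]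
  -- The remainder `z` is orthogonal to the vacuum and, by adjunction, to everything in the image of
  -- a creation operator; cyclicity makes it orthogonal to itself.
  have key : LinearMap.ker (innerₛₗ ℂ z) = ⊤ := by
    refine eq_top_of_vac_mem ?_ (fun n hn y _ => ?_) fun k hk y _ => ?_
    · rw [LinearMap.mem_ker, innerₛₗ_apply_apply, ← inner_conj_symm, hz, inner_sub_right,
        inner_smul_right, inner_vac_vac, mul_one, sub_self, map_zero]
    · rw [LinearMap.mem_ker, innerₛₗ_apply_apply, ← neg_neg n, ← inner_a, hza _ (by omega),
        inner_zero_left]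
    · rw [LinearMap.mem_ker, innerₛₗ_apply_apply, show k = -(-k - 1) - 1 by ring, ← inner_ψ,
        hzψ _ (by omega), inner_zero_left]
  have : z ∈ LinearMap.ker (innerₛₗ ℂ z) := key ▸ Submodule.mem_top
  rw [LinearMap.mem_ker, innerₛₗ_apply_apply, inner_self_eq_zero] at this
  exact sub_eq_zero.1 this

/-- An operator that commutes with all free fields is determined by its vacuum expectation. -/
theorem eq_smul_one {D : Module.End ℂ Fock} (ha : ∀ n, D * a n = a n * D)
    (hψ : ∀ k, D * ψ k = ψ k * D) : D = ⟪vac, D vac⟫_ℂ • 1 := by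
  have hD : D vac = ⟪vac, D vac⟫_ℂ • vac := eq_smul_vac
    (fun n hn => by
      rw [← Module.End.mul_apply, ← ha, Module.End.mul_apply, a_vac hn, map_zero])
    (fun n hn => by
      rw [← Module.End.mul_apply, ← hψ, Module.End.mul_apply, ψ_vac hn, map_zero])
  have key : LinearMap.ker (D - ⟪vac, D vac⟫_ℂ • 1) = ⊤ := by
    refine eq_top_of_vac_mem ?_ (fun n hn y hy => ?_) fun k hk y hy => ?_
    · simpa [sub_eq_zero] using hD
    · have := congrArg (a n) (LinearMap.mem_ker.1 hy)
      have h := congrArg (fun f : Module.End ℂ Fock => f y) (ha n)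
      simp only [Module.End.mul_apply] at h
      simpa [h] using this
    · have := congrArg (ψ k) (LinearMap.mem_ker.1 hy)
      have h := congrArg (fun f : Module.End ℂ Fock => f y) (hψ k)
      simp only [Module.End.mul_apply] at h
      simpa [h] using this
  exact sub_eq_zero.1 (LinearMap.ker_eq_top.1 key)

/-- An operator that commutes with the bosonic field, anticommutes with the fermionic field, and
has zero vacuum expectation, vanishes. -/
theorem eq_zero_of_anticomm {D : Module.End ℂ Fock} (ha : ∀ n, D * a n = a n * D)
    (hψ : ∀ k, D * ψ k = -(ψ k * D)) (h0 : ⟪vac, D vac⟫_ℂ = 0) : D = 0 := by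
  have hD : D vac = ⟪vac, D vac⟫_ℂ • vac := eq_smul_vac
    (fun n hn => by
      rw [← Module.End.mul_apply, ← ha, Module.End.mul_apply, a_vac hn, map_zero])
    (fun n hn => by
      rw [← Module.End.mul_apply, ← neg_neg (ψ n * D), ← hψ, LinearMap.neg_apply,
        Module.End.mul_apply, ψ_vac hn, map_zero, neg_zero])
  rw [h0, zero_smul] at hD
  refine LinearMap.ker_eq_top.1 (eq_top_of_vac_mem hD (fun n hn y hy => ?_) fun k hk y hy => ?_)
  · rw [LinearMap.mem_ker, ← Module.End.mul_apply, ha, Module.End.mul_apply,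
      LinearMap.mem_ker.1 hy, map_zero]
  · rw [LinearMap.mem_ker, ← Module.End.mul_apply, hψ, LinearMap.neg_apply, Module.End.mul_apply,
      LinearMap.mem_ker.1 hy, map_zero, neg_zero]

/-- The modes of the energy-momentum tensor of the free fields. -/
def L₀ (n : ℤ) : Module.End ℂ Fock := (1 / 2 : ℂ) • (G₀ 0 * G₀ (n - 1) + G₀ (n - 1) * G₀ 0)

/-- This is the Jacobi identity. The result depends only on `j + k`, as does that of
`G₀_anticomm_comm_a`. -/
theorem G₀_anticomm_comm_ψ (j k s : ℤ) :
    (G₀ j * G₀ k + G₀ k * G₀ j) * ψ s - ψ s * (G₀ j * G₀ k + G₀ k * G₀ j) =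
      (-((j : ℂ) + k + 2 * s + 2)) • ψ (j + k + 1 + s) := by
  have h1 := G₀_anticomm_ψ j s
  have h2 := G₀_anticomm_ψ k s
  have h3 := a_comm_G₀ (j + s + 1) k
  have h4 := a_comm_G₀ (k + s + 1) j
  rw [show k + (j + s + 1) = j + k + 1 + s by ring] at h3
  rw [show j + (k + s + 1) = j + k + 1 + s by ring] at h4
  rw [← h1] at h3
  rw [← h2] at h4
  push_cast at h3 h4
  simp only [mul_add, add_mul, mul_assoc] at h3 h4 ⊢
  linear_combination (norm := module) -h3 - h4

theorem G₀_anticomm_comm_a (j k m : ℤ) :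
    (G₀ j * G₀ k + G₀ k * G₀ j) * a m - a m * (G₀ j * G₀ k + G₀ k * G₀ j) =
      (-(2 * (m : ℂ))) • a (j + k + 1 + m) := by
  have h1 := a_comm_G₀ m j
  have h2 := a_comm_G₀ m k
  have h3 := G₀_anticomm_ψ j (k + m)
  have h4 := G₀_anticomm_ψ k (j + m)
  rw [show j + (k + m) + 1 = j + k + 1 + m by ring] at h3
  rw [show k + (j + m) + 1 = j + k + 1 + m by ring] at h4
  have e1 := congrArg (G₀ k * ·) h1
  have e2 := congrArg (· * G₀ k) h1
  have e3 := congrArg (G₀ j * ·) h2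
  have e4 := congrArg (· * G₀ j) h2
  simp only [mul_add, add_mul, mul_sub, sub_mul, mul_assoc, smul_mul_assoc, mul_smul_comm]
    at e1 e2 e3 e4 ⊢
  linear_combination (norm := module) -e1 - e2 - e3 - e4 - (m : ℂ) • h3 - (m : ℂ) • h4

theorem L₀_comm_ψ (n s : ℤ) :
    L₀ n * ψ s - ψ s * L₀ n = (-((s : ℂ) + (n + 1) / 2)) • ψ (n + s) := by
  have h := G₀_anticomm_comm_ψ 0 (n - 1) s
  rw [show 0 + (n - 1) + 1 + s = n + s by ring] at h
  push_cast at h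
  rw [L₀, smul_mul_assoc, mul_smul_comm]
  linear_combination (norm := module) (1 / 2 : ℂ) • h

theorem L₀_comm_a (n m : ℤ) : L₀ n * a m - a m * L₀ n = (-(m : ℂ)) • a (n + m) := by
  have h := G₀_anticomm_comm_a 0 (n - 1) m
  rw [show 0 + (n - 1) + 1 + m = n + m by ring] at h
  rw [L₀, smul_mul_assoc, mul_smul_comm]
  linear_combination (norm := module) (1 / 2 : ℂ) • h

theorem inner_vac_a {n : ℤ} (hn : n ≤ 0) (x : Fock) : ⟪vac, a n x⟫_ℂ = 0 := by
  rw [← neg_neg n, ← inner_a, a_vac (by omega), inner_zero_left]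

theorem inner_vac_ψ {k : ℤ} (hk : k < 0) (x : Fock) : ⟪vac, ψ k x⟫_ℂ = 0 := by
  rw [show k = -(-k - 1) - 1 by ring, ← inner_ψ, ψ_vac (by omega), inner_zero_left]

/-- When `G₀ j` is moved to the left through `a_n ψ_{k-n}`, only the full contraction survives
between vacua, and it contributes `-n`. -/
theorem inner_vac_G₀_G₀_vac (j k : ℤ) : ⟪vac, G₀ j (G₀ k vac)⟫_ℂ =
    if j + k + 1 = 0 then ∑ n ∈ Finset.Icc (-j) (-1), (-n : ℂ) else 0 := by
  have key : ∀ n ∈ Finset.Icc (k + 1) (-1), ⟪vac, G₀ j (a n (ψ (k - n) vac))⟫_ℂ =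
      if j + k + 1 = 0 then (-n : ℂ) else 0 := by
    intro n hn
    rw [Finset.mem_Icc] at hn
    have h1 := congrArg (fun f : Module.End ℂ Fock => f (ψ (k - n) vac)) (a_comm_G₀ n j)
    have h2 := congrArg (fun f : Module.End ℂ Fock => f vac) (ψ_anticomm_ψ' (j + n) (k - n))
    simp only [Module.End.mul_apply, LinearMap.sub_apply, LinearMap.add_apply,
      LinearMap.smul_apply, Module.End.one_apply] at h1 h2
    rw [← sub_sub_cancel (a n (G₀ j (ψ (k - n) vac))) (G₀ j (a n (ψ (k - n) vac))), h1,
      eq_sub_of_add_eq h2, inner_sub_right, inner_vac_a (by omega), inner_smul_right,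
      inner_sub_right, inner_vac_ψ (by omega), inner_smul_right, inner_vac_vac, delta,
      show j + n + (k - n) + 1 = j + k + 1 by ring]
    split_ifs <;> ring
  rw [G₀_vac_eq_sum, map_sum, inner_sum, Finset.sum_congr rfl key]
  split_ifs with h
  · rw [show k + 1 = -j by omega]
  · simp

theorem sum_Icc_neg (j : ℤ) (hj : 0 ≤ j) :
    ∑ n ∈ Finset.Icc (-j) (-1), (-n : ℂ) = j * (j + 1) / 2 := by
  induction j, hj using Int.leInduction with
  | base => simp
  | succ j hj ih =>
    have : Finset.Icc (-(j + 1)) (-1) = insert (-(j + 1)) (Finset.Icc (-j) (-1)) := by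
      ext n
      simp only [Finset.mem_Icc, Finset.mem_insert]
      omega
    rw [this, Finset.sum_insert (by simp), ih]
    push_cast
    ring

theorem vacuum_expectation_anticomm (j k : ℤ) :
    ⟪vac, (G₀ j * G₀ k + G₀ k * G₀ j) vac⟫_ℂ = cocycle (3 / 2) j k := by
  simp only [LinearMap.add_apply, Module.End.mul_apply, inner_add_right, inner_vac_G₀_G₀_vac,
    cocycle, add_comm k j]
  split_ifs with h
  · obtain rfl : k = -j - 1 := by omega
    -- Exactly one of the two orders has a possibly nonempty range of summation, depending on the
    -- sign of `j`.
    rcases le_or_gt 0 j with hj | hj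
    · rw [sum_Icc_neg j hj, Finset.Icc_eq_empty (by omega)]
      simp only [Finset.sum_empty]
      ring
    · rw [sum_Icc_neg (-j - 1) (by omega), Finset.Icc_eq_empty (by omega)]
      simp only [Finset.sum_empty]
      push_cast
      ring
  · simp

/-- Two anticommutators with the same `j + k` have equal brackets with the free fields, so they
differ by a scalar, which the vacuum expectations give. The reference pair `(0, j + k)` has `r =
1/2` and no central term, so it can define `L₀`. -/
theorem G₀_anticomm_G₀ (j k : ℤ) :
    G₀ j * G₀ k + G₀ k * G₀ j = (2 : ℂ) • L₀ (j + k + 1) + cocycle (3 / 2) j k • 1 := by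
  have hD := eq_smul_one
    (D := (G₀ j * G₀ k + G₀ k * G₀ j) - (G₀ 0 * G₀ (j + k) + G₀ (j + k) * G₀ 0))
    (fun m => by
      have h1 := G₀_anticomm_comm_a j k m
      have h2 := G₀_anticomm_comm_a 0 (j + k) m
      rw [zero_add] at h2
      rw [sub_mul, mul_sub]
      linear_combination (norm := module) h1 - h2)
    (fun s => by
      have h1 := G₀_anticomm_comm_ψ j k s
      have h2 := G₀_anticomm_comm_ψ 0 (j + k) s
      rw [zero_add] at h2
      push_cast at h2
      rw [sub_mul, mul_sub]
      linear_combination (norm := module) h1 - h2)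
  have h0 : cocycle (3 / 2) 0 (j + k) = 0 := by
    rw [cocycle]
    split_ifs <;> norm_num
  rw [LinearMap.sub_apply, inner_sub_right, vacuum_expectation_anticomm,
    vacuum_expectation_anticomm, h0, sub_zero] at hD
  rw [L₀, add_sub_cancel_right]
  linear_combination (norm := module) hD

/-- Adjunction turns the defining pair `(0, n - 1)` into `(-1, -n)`; now `r = -1/2`, and again there
is no central term. -/
theorem inner_L₀ (n : ℤ) (x y : Fock) : ⟪L₀ n x, y⟫_ℂ = ⟪x, L₀ (-n) y⟫_ℂ := by
  have h := congrArg (fun f : Module.End ℂ Fock => f y) (G₀_anticomm_G₀ (-1) (-n))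
  have h0 : cocycle (3 / 2) (-1) (-n) = 0 := by
    rw [cocycle]
    split_ifs <;> norm_num
  rw [h0, show -1 + -n + 1 = -n by ring] at h
  simp only [LinearMap.add_apply, Module.End.mul_apply, LinearMap.smul_apply, zero_smul,
    add_zero] at h
  have e1 := inner_G₀ 0 (G₀ (n - 1) x) y
  have e2 := inner_G₀ (n - 1) x (G₀ (-1) y)
  have e3 := inner_G₀ (n - 1) (G₀ 0 x) y
  have e4 := inner_G₀ 0 x (G₀ (-n) y)
  rw [show -(n - 1) - 1 = -n by ring] at e2 e3
  rw [show (-0 - 1 : ℤ) = -1 by ring] at e1 e4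
  have := congrArg (fun z => ⟪x, z⟫_ℂ) h
  simp only [inner_add_right, inner_smul_right] at this
  rw [L₀, LinearMap.smul_apply, inner_smul_left, LinearMap.add_apply, Module.End.mul_apply,
    Module.End.mul_apply, inner_add_left, e1, e2, e3, e4, add_comm, this, map_div₀, map_one,
    Complex.conj_ofNat]
  ring

theorem inner_vac_G₀_vac (k : ℤ) : ⟪vac, G₀ k vac⟫_ℂ = 0 := by
  rw [G₀_vac_eq_sum, inner_sum]
  refine Finset.sum_eq_zero fun n hn => inner_vac_a ?_ _
  rw [Finset.mem_Icc] at hn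
  omega

theorem inner_vac_L₀_G₀_vac (n k : ℤ) : ⟪vac, L₀ n (G₀ k vac)⟫_ℂ = 0 := by
  rw [G₀_vac_eq_sum, map_sum, inner_sum]
  refine Finset.sum_eq_zero fun p hp => ?_
  rw [Finset.mem_Icc] at hp
  have h1 := congrArg (fun f : Module.End ℂ Fock => f (ψ (k - p) vac)) (L₀_comm_a n p)
  have h2 := congrArg (fun f : Module.End ℂ Fock => f vac) (a_comm_ψ (n + p) (k - p))
  simp only [Module.End.mul_apply, LinearMap.sub_apply, LinearMap.smul_apply] at h1 h2
  rw [sub_eq_iff_eq_add.1 h1, h2, inner_add_right, inner_smul_right, inner_vac_ψ (by omega),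
    inner_vac_a (by omega), mul_zero, add_zero]

/-- By the Jacobi identity the difference of the two sides commutes with the bosonic modes and
anticommutes with the fermionic ones, and its vacuum expectation is zero. -/
theorem L₀_comm_G₀ (n k : ℤ) :
    L₀ n * G₀ k - G₀ k * L₀ n = ((n : ℂ) / 2 - (k + 1 / 2)) • G₀ (n + k) := by
  rw [← sub_eq_zero]
  refine eq_zero_of_anticomm (fun m => ?_) (fun s => ?_) ?_
  · have h1 := L₀_comm_a n m
    have h2 := a_comm_G₀ m k
    have h3 := L₀_comm_ψ n (k + m)
    have h4 := a_comm_G₀ m (n + k)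
    have h5 := a_comm_G₀ (n + m) k
    rw [show n + (k + m) = n + k + m by ring] at h3
    rw [show k + (n + m) = n + k + m by ring] at h5
    have e1 := congrArg (G₀ k * ·) h1
    have e2 := congrArg (· * G₀ k) h1
    have e3 := congrArg (L₀ n * ·) h2
    have e4 := congrArg (· * L₀ n) h2
    push_cast at h3 h4 h5
    simp only [mul_sub, sub_mul, mul_assoc, smul_mul_assoc, mul_smul_comm] at e1 e2 e3 e4 ⊢
    linear_combination (norm := module) e2 - e1 - e3 + e4 - (m : ℂ) • h3 - (m : ℂ) • h5 +
      ((n : ℂ) / 2 - (k + 1 / 2)) • h4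
  · have h1 := L₀_comm_ψ n s
    have h2 := G₀_anticomm_ψ k s
    have h3 := L₀_comm_a n (k + s + 1)
    have h4 := G₀_anticomm_ψ (n + k) s
    have h5 := G₀_anticomm_ψ k (n + s)
    rw [show n + (k + s + 1) = n + k + s + 1 by ring] at h3
    rw [show k + (n + s) + 1 = n + k + s + 1 by ring] at h5
    have e1 := congrArg (G₀ k * ·) h1
    have e2 := congrArg (· * G₀ k) h1
    rw [← h2] at h3
    push_cast at h3 h4 h5
    simp only [mul_add, add_mul, mul_sub, sub_mul, mul_assoc, smul_mul_assoc, mul_smul_comm]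
      at e1 e2 h3 ⊢
    linear_combination (norm := module) h3 - e2 - e1 + ((s : ℂ) + (n + 1) / 2) • h5 -
      ((n : ℂ) / 2 - (k + 1 / 2)) • h4
  · rw [LinearMap.sub_apply, LinearMap.sub_apply, inner_sub_right, inner_sub_right,
      Module.End.mul_apply, Module.End.mul_apply, inner_vac_L₀_G₀_vac, LinearMap.smul_apply,
      inner_smul_right, inner_vac_G₀_vac, mul_zero, sub_zero, zero_sub, neg_eq_zero]
    nth_rw 1 [show k = -(-k - 1) - 1 by ring]
    rw [← inner_G₀, ← inner_conj_symm, inner_L₀, inner_vac_L₀_G₀_vac, map_zero]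

/-! ### The deformation that raises the central charge. -/

/-- The operator `G_{k + 1/2} + G_{k + 3/2}` of the free field representation in which the odd field
is deformed by a total derivative term that is singular at the point `-1` of the circle. -/
def H (κ : ℝ) (k : ℤ) : Module.End ℂ Fock :=
  (G₀ k + G₀ (k + 1)) + (Complex.I * κ * (k + 1)) • (ψ k + ψ (k + 1))

/-- The operator `L_n + 2 L_{n + 1} + L_{n + 2}` of the deformed free field representation. -/
def T (κ : ℝ) (n : ℤ) : Module.End ℂ Fock :=
  (L₀ n + (2 : ℂ) • L₀ (n + 1) + L₀ (n + 2)) +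
    (Complex.I * κ * (n + 1) / 2) • (a n + (2 : ℂ) • a (n + 1) + a (n + 2))

/-- The mixed terms add up to `iκ(j + k + 2)` times bosonic modes, twice the linear part of `T`; the
term quadratic in `κ` is scalar and is absorbed by `cocycle'_add`. -/
theorem H_anticomm_H (κ : ℝ) (j k : ℤ) :
    H κ j * H κ k + H κ k * H κ j =
      (2 : ℂ) • T κ (j + k + 1) + cocycle' (3 / 2 + 3 * (κ : ℂ) ^ 2) j k • 1 := by
  have hG := shifted_anticomm G₀_anticomm_G₀ j k
  have h1 (j k : ℤ) : (G₀ j + G₀ (j + 1)) * (ψ k + ψ (k + 1)) +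
      (ψ k + ψ (k + 1)) * (G₀ j + G₀ (j + 1)) =
        a (j + k + 1) + (2 : ℂ) • a (j + k + 1 + 1) + a (j + k + 1 + 2) := by
    have h0 := G₀_anticomm_ψ j k
    have h1 := G₀_anticomm_ψ (j + 1) k
    have h2 := G₀_anticomm_ψ j (k + 1)
    have h3 := G₀_anticomm_ψ (j + 1) (k + 1)
    rw [show j + 1 + k + 1 = j + k + 1 + 1 by ring] at h1
    rw [show j + (k + 1) + 1 = j + k + 1 + 1 by ring] at h2
    rw [show j + 1 + (k + 1) + 1 = j + k + 1 + 2 by ring] at h3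
    simp only [add_mul, mul_add]
    linear_combination (norm := module) h0 + h1 + h2 + h3
  have h2 := h1 k j
  rw [show k + j + 1 = j + k + 1 by ring] at h2
  have h3 : (ψ j + ψ (j + 1)) * (ψ k + ψ (k + 1)) + (ψ k + ψ (k + 1)) * (ψ j + ψ (j + 1)) =
      (delta j k + delta (j + 1) k + delta j (k + 1) + delta (j + 1) (k + 1)) • 1 := by
    simp only [add_mul, mul_add]
    linear_combination (norm := module) ψ_anticomm_ψ' j k + ψ_anticomm_ψ' (j + 1) k +
      ψ_anticomm_ψ' j (k + 1) + ψ_anticomm_ψ' (j + 1) (k + 1)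
  have hI : Complex.I * Complex.I = -1 := Complex.I_mul_I
  have h4 : (Complex.I * κ * (j + 1)) * (Complex.I * κ * (k + 1)) =
      -((κ : ℂ) ^ 2 * (j + 1) * (k + 1)) := by linear_combination (κ : ℂ) ^ 2 * (j + 1) * (k + 1) * hI
  have h5 := h1 j k
  simp only [H, T, cocycle'_add]
  generalize G₀ j + G₀ (j + 1) = g at *
  generalize G₀ k + G₀ (k + 1) = g' at *
  generalize ψ j + ψ (j + 1) = x at *
  generalize ψ k + ψ (k + 1) = x' at *
  have h6 : ((Complex.I * κ * (j + 1)) * (Complex.I * κ * (k + 1))) • (x * x' + x' * x) =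
      (-((κ : ℂ) ^ 2 * (j + 1) * (k + 1)) *
        (delta j k + delta (j + 1) k + delta j (k + 1) + delta (j + 1) (k + 1))) • 1 := by
    rw [h3, h4, smul_smul]
  push_cast
  simp only [add_mul, mul_add, smul_mul_assoc, mul_smul_comm, smul_add, smul_smul] at h6 ⊢
  linear_combination (norm := module) hG + (Complex.I * κ * (k + 1)) • h5 +
    (Complex.I * κ * (j + 1)) • h2 + h6

theorem T_comm_H (κ : ℝ) (n k : ℤ) :
    T κ n * H κ k - H κ k * T κ n = ((n : ℂ) / 2 - (k + 1 / 2)) • (H κ (n + k) +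
      (2 : ℂ) • H κ (n + k + 1) + H κ (n + k + 2)) := by
  have hG := shifted_comm L₀_comm_G₀ n k
  have h1 : (L₀ n + (2 : ℂ) • L₀ (n + 1) + L₀ (n + 2)) * (ψ k + ψ (k + 1)) -
      (ψ k + ψ (k + 1)) * (L₀ n + (2 : ℂ) • L₀ (n + 1) + L₀ (n + 2)) =
      -(((k : ℂ) + (n + 1) / 2) • ((ψ (n + k) + ψ (n + k + 1)) +
        (2 : ℂ) • (ψ (n + k + 1) + ψ (n + k + 2)) + (ψ (n + k + 2) + ψ (n + k + 3))) +
        (2 : ℂ) • (ψ (n + k + 1) + (2 : ℂ) • ψ (n + k + 2) + ψ (n + k + 3))) := by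
    have h0 := L₀_comm_ψ n k
    have h1 := L₀_comm_ψ n (k + 1)
    have h2 := L₀_comm_ψ (n + 1) k
    have h3 := L₀_comm_ψ (n + 1) (k + 1)
    have h4 := L₀_comm_ψ (n + 2) k
    have h5 := L₀_comm_ψ (n + 2) (k + 1)
    rw [show n + (k + 1) = n + k + 1 by ring] at h1
    rw [show n + 1 + k = n + k + 1 by ring] at h2
    rw [show n + 1 + (k + 1) = n + k + 2 by ring] at h3
    rw [show n + 2 + k = n + k + 2 by ring] at h4
    rw [show n + 2 + (k + 1) = n + k + 3 by ring] at h5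
    push_cast at h0 h1 h2 h3 h4 h5
    simp only [add_mul, mul_add, smul_mul_assoc, mul_smul_comm]
    linear_combination (norm := module) h0 + h1 + (2 : ℂ) • h2 + (2 : ℂ) • h3 + h4 + h5
  have h2 : (a n + (2 : ℂ) • a (n + 1) + a (n + 2)) * (G₀ k + G₀ (k + 1)) -
      (G₀ k + G₀ (k + 1)) * (a n + (2 : ℂ) • a (n + 1) + a (n + 2)) =
      (n : ℂ) • (ψ (n + k) + ψ (n + k + 1)) +
        (2 * ((n : ℂ) + 1)) • (ψ (n + k + 1) + ψ (n + k + 2)) +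
        ((n : ℂ) + 2) • (ψ (n + k + 2) + ψ (n + k + 3)) := by
    have h0 := a_comm_G₀ n k
    have h1 := a_comm_G₀ n (k + 1)
    have h2 := a_comm_G₀ (n + 1) k
    have h3 := a_comm_G₀ (n + 1) (k + 1)
    have h4 := a_comm_G₀ (n + 2) k
    have h5 := a_comm_G₀ (n + 2) (k + 1)
    rw [show k + n = n + k by ring] at h0
    rw [show k + 1 + n = n + k + 1 by ring] at h1
    rw [show k + (n + 1) = n + k + 1 by ring] at h2
    rw [show k + 1 + (n + 1) = n + k + 2 by ring] at h3
    rw [show k + (n + 2) = n + k + 2 by ring] at h4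
    rw [show k + 1 + (n + 2) = n + k + 3 by ring] at h5
    push_cast at h0 h1 h2 h3 h4 h5
    simp only [add_mul, mul_add, smul_mul_assoc, mul_smul_comm]
    linear_combination (norm := module) h0 + h1 + (2 : ℂ) • h2 + (2 : ℂ) • h3 + h4 + h5
  have h3 : (a n + (2 : ℂ) • a (n + 1) + a (n + 2)) * (ψ k + ψ (k + 1)) =
      (ψ k + ψ (k + 1)) * (a n + (2 : ℂ) • a (n + 1) + a (n + 2)) := by
    simp only [add_mul, mul_add, smul_mul_assoc, mul_smul_comm, a_comm_ψ]
    module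
  simp only [H, T]
  generalize L₀ n + (2 : ℂ) • L₀ (n + 1) + L₀ (n + 2) = l at *
  generalize G₀ k + G₀ (k + 1) = g at *
  generalize a n + (2 : ℂ) • a (n + 1) + a (n + 2) = b at *
  generalize ψ k + ψ (k + 1) = x at *
  have h4 := congrArg ((Complex.I * κ * (n + 1) / 2 * (Complex.I * κ * (k + 1))) • ·) h3
  rw [show n + k + 1 + 1 = n + k + 2 by ring, show n + k + 2 + 1 = n + k + 3 by ring]
  push_cast
  simp only [add_mul, mul_add, smul_mul_assoc, mul_smul_comm]
  linear_combination (norm := module) hG + (Complex.I * κ * (k + 1)) • h1 +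
    (Complex.I * κ * (n + 1) / 2) • h2 + h4

/-- The only creation operator that could contribute is `ψ (-1)`, at `k = -1`, where the factor `k +
1` vanishes. -/
theorem H_vac (κ : ℝ) {k : ℤ} (hk : -1 ≤ k) : H κ k vac = 0 := by
  rw [H, LinearMap.add_apply, LinearMap.add_apply, G₀_vac hk, G₀_vac (by omega)]
  rcases hk.eq_or_lt with rfl | hk
  · simp
  · simp [ψ_vac (show 0 ≤ k by omega), ψ_vac (show 0 ≤ k + 1 by omega)]

/-- The reflection `k ↦ -k - 2` reverses the sign of `k + 1`, which compensates the conjugation of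
`i`. This needs `κ` to be real. -/
theorem inner_H (κ : ℝ) (k : ℤ) (x y : Fock) : ⟪H κ k x, y⟫_ℂ = ⟪x, H κ (-k - 2) y⟫_ℂ := by
  simp only [H, LinearMap.add_apply, LinearMap.smul_apply, inner_add_left, inner_add_right,
    inner_smul_left, inner_smul_right, inner_G₀, inner_ψ]
  rw [show -(k + 1) - 1 = -k - 2 by ring, show -k - 2 + 1 = -k - 1 by ring]
  simp only [map_mul, map_add, map_one, Complex.conj_I, Complex.conj_ofReal, map_intCast]
  push_cast
  ring

end

end FreeFock

/-! ### Subspaces generated by lowering operators. -/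

namespace NeveuSchwarz

section LowClosure

variable {M : Type*} [AddCommGroup M] [Module ℂ M]

/-- The smallest subspace that contains `u` and is mapped into itself by all `A k` with `k < 0`. -/
def lowClosure (A : ℤ → Module.End ℂ M) (u : M) : Submodule ℂ M :=
  sInf {S | u ∈ S ∧ ∀ k < 0, ∀ x ∈ S, A k x ∈ S}

variable {A B : ℤ → Module.End ℂ M} {u : M}

theorem mem_lowClosure_self : u ∈ lowClosure A u :=
  Submodule.mem_sInf.2 fun _ hS => hS.1

theorem lowClosure_closed {k : ℤ} (hk : k < 0) {x : M} (hx : x ∈ lowClosure A u) :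
    A k x ∈ lowClosure A u :=
  Submodule.mem_sInf.2 fun S hS => hS.2 k hk x (Submodule.mem_sInf.1 hx S hS)

theorem lowClosure_le {S : Submodule ℂ M} (hu : u ∈ S)
    (h : ∀ k < 0, ∀ x ∈ lowClosure A u, x ∈ S → A k x ∈ S) : lowClosure A u ≤ S := by
  have : lowClosure A u ≤ S ⊓ lowClosure A u :=
    sInf_le ⟨⟨hu, mem_lowClosure_self⟩, fun k hk x hx =>
      ⟨h k hk x hx.2 hx.1, lowClosure_closed hk hx.2⟩⟩
  exact this.trans inf_le_left

/-- The subspace of the vectors which are mapped into `W` by all `A k` and all `B n`. -/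
def stabilized (A B : ℤ → Module.End ℂ M) (W : Submodule ℂ M) : Submodule ℂ M :=
  (⨅ k, W.comap (A k)) ⊓ ⨅ n, W.comap (B n)

theorem mem_stabilized {W : Submodule ℂ M} {x : M} :
    x ∈ stabilized A B W ↔ (∀ k, A k x ∈ W) ∧ ∀ n, B n x ∈ W := by
  simp [stabilized]

theorem even_mem_of_odd_mem {e : ℤ → ℤ → ℂ}
    (hAA : ∀ j k, A j * A k + A k * A j = (2 : ℂ) • B (j + k + 1) + e j k • 1)
    {W : Submodule ℂ M} {x : M} (hx : x ∈ W) (j k : ℤ) (h : A j (A k x) + A k (A j x) ∈ W) :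
    B (j + k + 1) x ∈ W := by
  have := congrArg (fun f : Module.End ℂ M => f x) (hAA j k)
  simp only [LinearMap.add_apply, Module.End.mul_apply, LinearMap.smul_apply,
    Module.End.one_apply] at this
  rw [this, Submodule.add_mem_iff_left _ (W.smul_mem _ hx)] at h
  rwa [Submodule.smul_mem_iff _ two_ne_zero] at h

/-- The subspace generated from a lowest weight vector by the lowering operators is invariant. -/
theorem lowClosure_invariant {e : ℤ → ℤ → ℂ}
    (hAA : ∀ j k, A j * A k + A k * A j = (2 : ℂ) • B (j + k + 1) + e j k • 1)
    (hBA : ∀ n k x, (B n * A k - A k * B n) x ∈ Submodule.span ℂ (Set.range fun i => A i x))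
    (hA : ∀ k, 0 ≤ k → A k u = 0) (hB : ∃ h : ℂ, B 0 u = h • u) {x : M}
    (hx : x ∈ lowClosure A u) :
    (∀ k, A k x ∈ lowClosure A u) ∧ ∀ n, B n x ∈ lowClosure A u := by
  suffices H : lowClosure A u ≤ stabilized A B (lowClosure A u) from mem_stabilized.1 (H hx)
  -- For `n < 0`, up to a scalar, `B n` is half the anticommutator of `A (-1)` and `A n`, which both
  -- preserve the closure.
  have hneg {n : ℤ} (hn : n < 0) {x : M} (hx : x ∈ lowClosure A u) : B n x ∈ lowClosure A u := by
    have := even_mem_of_odd_mem hAA hx (-1) n (Submodule.add_mem _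
      (lowClosure_closed (by omega) (lowClosure_closed hn hx))
      (lowClosure_closed hn (lowClosure_closed (by omega) hx)))
    rwa [show -1 + n + 1 = n by ring] at this
  refine lowClosure_le (mem_stabilized.2 ⟨fun k => ?_, fun n => ?_⟩) fun s hs x hx hxs =>
    mem_stabilized.2 ?_
  · rcases lt_or_ge k 0 with hk | hk
    · exact lowClosure_closed hk mem_lowClosure_self
    · rw [hA k hk]
      exact Submodule.zero_mem _
  · rcases lt_trichotomy n 0 with hn | rfl | hn
    · exact hneg hn mem_lowClosure_self
    · obtain ⟨h, hh⟩ := hB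
      rw [hh]
      exact Submodule.smul_mem _ _ mem_lowClosure_self
    · have := even_mem_of_odd_mem hAA (mem_lowClosure_self (A := A) (u := u)) 0 (n - 1) (by
        rw [hA 0 le_rfl, hA (n - 1) (by omega), map_zero, map_zero, add_zero]
        exact Submodule.zero_mem _)
      rwa [show 0 + (n - 1) + 1 = n by ring] at this
  · obtain ⟨h1, h2⟩ := mem_stabilized.1 hxs
    refine ⟨fun k => ?_, fun n => ?_⟩
    · have := congrArg (fun f : Module.End ℂ M => f x) (hAA k s)
      simp only [LinearMap.add_apply, Module.End.mul_apply] at this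
      rw [eq_sub_of_add_eq this]
      exact Submodule.sub_mem _ (Submodule.add_mem _ (Submodule.smul_mem _ _ (h2 _))
        (Submodule.smul_mem _ _ hx)) (lowClosure_closed hs (h1 k))
    · have h3 : (B n * A s - A s * B n) x ∈ lowClosure A u := by
        refine Submodule.span_le.2 ?_ (hBA n s x)
        rintro _ ⟨i, rfl⟩
        exact h1 i
      rw [← sub_add_cancel (B n (A s x)) (A s (B n x))]
      exact Submodule.add_mem _ h3 (lowClosure_closed hs (h2 n))

end LowClosure

end NeveuSchwarz

/-! ### Weights, the vacuum functional and irreducibility. -/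

namespace NSRepresentation

open NeveuSchwarz

variable {c : ℂ} {V : Type*} [AddCommGroup V] [Module ℂ V] {ρ : NSRepresentation c V} {Ω : V}

theorem G_anticomm (ρ : NSRepresentation c V) (j k : ℤ) :
    ρ.G j * ρ.G k + ρ.G k * ρ.G j = (2 : ℂ) • ρ.L (j + k + 1) + cocycle c j k • 1 :=
  ρ.G_anticomm_G j k

theorem G_anticomm_apply (ρ : NSRepresentation c V) (j k : ℤ) (x : V) :
    ρ.G j (ρ.G k x) + ρ.G k (ρ.G j x) = (2 : ℂ) • ρ.L (j + k + 1) x + cocycle c j k • x :=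
  congrArg (fun f : Module.End ℂ V => f x) (ρ.G_anticomm j k)

theorem L_comm_G_apply (ρ : NSRepresentation c V) (n k : ℤ) (x : V) :
    ρ.L n (ρ.G k x) - ρ.G k (ρ.L n x) = ((n : ℂ) / 2 - (k + 1 / 2)) • ρ.G (n + k) x :=
  congrArg (fun f : Module.End ℂ V => f x) (ρ.L_comm_G n k)

theorem isInvariant_lowClosure {u : V} (hG : ∀ k, 0 ≤ k → ρ.G k u = 0)
    (hL : ∃ h : ℂ, ρ.L 0 u = h • u) : ρ.IsInvariant (lowClosure ρ.G u) := by
  have h {x : V} := lowClosure_invariant (x := x) ρ.G_anticomm (fun n k x => by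
    rw [ρ.L_comm_G]
    exact Submodule.smul_mem _ _ (Submodule.subset_span ⟨n + k, rfl⟩)) hG hL
  exact ⟨fun m w hw => (h hw).2 m, fun k w hw => (h hw).1 k⟩

theorem lowClosure_eq_top {h : ℂ} (hΩ : ρ.IsLowestWeightVector h Ω) (hcyc : ρ.IsCyclicVector Ω) :
    lowClosure ρ.G Ω = ⊤ :=
  hcyc _ (isInvariant_lowClosure hΩ.2.2.2 ⟨h, hΩ.2.1⟩) mem_lowClosure_self

/-- The sum of the eigenspaces of `L_0` of the positive half-integral weights. -/
noncomputable def positiveWeights (ρ : NSRepresentation c V) : Submodule ℂ V :=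
  ⨆ n : ℕ, (ρ.L 0).eigenspace (((n : ℂ) + 1) / 2)

theorem notMem_positiveWeights {x : V} (hx : x ≠ 0) (h : ρ.L 0 x = 0) :
    x ∉ ρ.positiveWeights := by
  intro hS
  have hle : ρ.positiveWeights ≤ ⨆ μ, ⨆ _ : μ ≠ 0, (ρ.L 0).eigenspace μ := by
    refine iSup_le fun n => le_iSup₂_of_le (((n : ℂ) + 1) / 2) ?_ le_rfl
    have : ((n : ℂ) + 1) ≠ 0 := by exact_mod_cast n.succ_ne_zero
    exact div_ne_zero this two_ne_zero
  refine hx (Submodule.disjoint_def.1 ((ρ.L 0).eigenspaces_iSupIndep 0) x ?_ (hle hS))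
  rw [Module.End.mem_eigenspace_iff, h, zero_smul]

theorem map_positiveWeights_of_commute {f : Module.End ℂ V} (hf : ∀ x, f (ρ.L 0 x) = ρ.L 0 (f x))
    {x : V} (hx : x ∈ ρ.positiveWeights) : f x ∈ ρ.positiveWeights := by
  suffices H : ρ.positiveWeights ≤ ρ.positiveWeights.comap f from H hx
  refine iSup_le fun n y hy => ?_
  refine (le_iSup (fun n : ℕ => (ρ.L 0).eigenspace (((n : ℂ) + 1) / 2)) n :) ?_
  rw [Module.End.mem_eigenspace_iff] at hy ⊢
  rw [← hf, hy, map_smul]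

theorem G_eigenvector {x : V} {μ : ℂ} (h : ρ.L 0 x = μ • x) (k : ℤ) :
    ρ.L 0 (ρ.G k x) = (μ - (k + 1 / 2)) • ρ.G k x := by
  have := ρ.L_comm_G_apply 0 k x
  rw [h, zero_add, map_smul] at this
  linear_combination (norm := module) this

theorem G_mem_positiveWeights {k : ℤ} (hk : k < 0) {x : V} (n : ℕ)
    (h : ρ.L 0 x = ((n : ℂ) / 2) • x) : ρ.G k x ∈ ρ.positiveWeights := by
  refine (le_iSup (fun n : ℕ => (ρ.L 0).eigenspace (((n : ℂ) + 1) / 2))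
    -- The new weight is `n/2 - (k + 1/2) = ((n - 2k - 2) + 1)/2`.
    (n + (-2 * k - 2).toNat) :) ?_
  rw [Module.End.mem_eigenspace_iff, G_eigenvector h k]
  have h2 : (((-2 * k - 2).toNat : ℤ) : ℂ) = ((-2 * k - 2 : ℤ) : ℂ) := by
    rw [Int.toNat_of_nonneg (by omega)]
  push_cast at h2 ⊢
  rw [h2]
  congr 1
  ring

theorem G_mem_positiveWeights_of_mem {k : ℤ} (hk : k < 0) {x : V} (hx : x ∈ ρ.positiveWeights) :
    ρ.G k x ∈ ρ.positiveWeights := by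
  suffices H : ρ.positiveWeights ≤ ρ.positiveWeights.comap (ρ.G k) from H hx
  refine iSup_le fun n y hy => G_mem_positiveWeights hk (n + 1) ?_
  rw [Module.End.mem_eigenspace_iff] at hy
  rw [hy]
  push_cast
  rfl

theorem span_sup_positiveWeights (hΩ : ρ.IsLowestWeightVector 0 Ω) (hcyc : ρ.IsCyclicVector Ω) :
    Submodule.span ℂ {Ω} ⊔ ρ.positiveWeights = ⊤ := by
  rw [eq_top_iff, ← lowClosure_eq_top hΩ hcyc]
  refine lowClosure_le (Submodule.mem_sup_left (Submodule.mem_span_singleton_self Ω))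
    fun k hk x _ hx => Submodule.mem_sup_right ?_
  obtain ⟨y, hy, z, hz, rfl⟩ := Submodule.mem_sup.1 hx
  obtain ⟨t, rfl⟩ := Submodule.mem_span_singleton.1 hy
  rw [map_add, map_smul]
  refine Submodule.add_mem _ (Submodule.smul_mem _ _ (G_mem_positiveWeights hk 0 ?_))
    (G_mem_positiveWeights_of_mem hk hz)
  rw [hΩ.2.1]
  simp

/-- A functional with the properties of the vacuum expectation. -/
structure IsVacuumFunctional (ρ : NSRepresentation c V) (Ω : V) (ω : V →ₗ[ℂ] ℂ) : Prop where
  apply_vac : ω Ω = 1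
  apply_L_zero : ∀ x, ω (ρ.L 0 x) = 0
  apply_G_neg : ∀ k < 0, ∀ x, ω (ρ.G k x) = 0
  apply_of_commute : ∀ f : Module.End ℂ V, (∀ x, f (ρ.L 0 x) = ρ.L 0 (f x)) →
    ∀ x, ω x = 0 → ω (f x) = 0

/-- The space is `ℂ Ω` plus the positive weights, and `Ω` lies outside the latter because
eigenspaces are independent; a functional separating the two is normalised at `Ω`. -/
theorem exists_isVacuumFunctional (hΩ : ρ.IsLowestWeightVector 0 Ω)
    (hcyc : ρ.IsCyclicVector Ω) : ∃ ω, ρ.IsVacuumFunctional Ω ω := by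
  have hL : ρ.L 0 Ω = 0 := by rw [hΩ.2.1, zero_smul]
  obtain ⟨f, hf, hker⟩ := Submodule.exists_le_ker_of_notMem (notMem_positiveWeights hΩ.1 hL)
  have hker' : ∀ x ∈ ρ.positiveWeights, f x = 0 := fun x hx => hker hx
  have hdec (x : V) : ∃ t : ℂ, ∃ z ∈ ρ.positiveWeights, x = t • Ω + z := by
    have hx : x ∈ Submodule.span ℂ {Ω} ⊔ ρ.positiveWeights :=
      span_sup_positiveWeights hΩ hcyc ▸ Submodule.mem_top
    obtain ⟨y, hy, z, hz, rfl⟩ := Submodule.mem_sup.1 hx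
    obtain ⟨t, rfl⟩ := Submodule.mem_span_singleton.1 hy
    exact ⟨t, z, hz, rfl⟩
  refine ⟨(f Ω)⁻¹ • f, by simp [hf], fun x => ?_, fun k hk x => ?_, fun g hg x hx => ?_⟩
  · obtain ⟨t, z, hz, rfl⟩ := hdec x
    simp [hL, hker' _ (map_positiveWeights_of_commute (fun _ => rfl) hz)]
  · obtain ⟨t, z, hz, rfl⟩ := hdec x
    simp [hker' _ (G_mem_positiveWeights_of_mem hk hz),
      hker' _ (G_mem_positiveWeights hk 0 (x := Ω) (by simp [hL]))]
  · obtain ⟨t, z, hz, rfl⟩ := hdec x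
    have ht : t = 0 := by simpa [hker' z hz, hf] using hx
    simp [ht, hker' _ (map_positiveWeights_of_commute hg hz)]

namespace IsVacuumFunctional

variable {ω : V →ₗ[ℂ] ℂ}

theorem apply_L_nonpos (hω : ρ.IsVacuumFunctional Ω ω) {m : ℤ} (hm : m ≤ 0) (x : V) :
    ω (ρ.L m x) = 0 := by
  rcases hm.eq_or_lt with rfl | hm
  · exact hω.apply_L_zero x
  have h := congrArg ω (ρ.G_anticomm_apply (-1) m x)
  have h0 : cocycle c (-1) m = 0 := by
    rw [cocycle]
    split_ifs <;> norm_num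
  rw [map_add, hω.apply_G_neg _ (by omega), hω.apply_G_neg _ hm, h0, zero_smul, add_zero, add_zero,
    show -1 + m + 1 = m by ring, map_smul] at h
  simpa using h.symm

/-- Anticommuting `G 0` past a lowering operator leaves `L (k + 1)` with `k + 1 ≤ 0`, which `ω`
annihilates, and no central term. -/
theorem apply_G_zero (hω : ρ.IsVacuumFunctional Ω ω) (hΩ : ρ.IsLowestWeightVector 0 Ω)
    (hcyc : ρ.IsCyclicVector Ω) (x : V) : ω (ρ.G 0 x) = 0 := by
  suffices H : lowClosure ρ.G Ω ≤ LinearMap.ker (ω ∘ₗ ρ.G 0) by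
    rw [lowClosure_eq_top hΩ hcyc] at H
    exact H Submodule.mem_top
  refine lowClosure_le ?_ fun k hk x _ _ => ?_
  · simp [hΩ.2.2.2 0 le_rfl]
  · have h := congrArg ω (ρ.G_anticomm_apply 0 k x)
    have h0 : cocycle c 0 k = 0 := by
      rw [cocycle]
      split_ifs <;> norm_num
    rw [map_add, hω.apply_G_neg k hk, h0, zero_smul, add_zero, add_zero, map_smul,
      hω.apply_L_nonpos (by omega), smul_zero] at h
    exact h

theorem apply_L_one (hω : ρ.IsVacuumFunctional Ω ω) (hΩ : ρ.IsLowestWeightVector 0 Ω)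
    (hcyc : ρ.IsCyclicVector Ω) (x : V) : ω (ρ.L 1 x) = 0 := by
  have h := congrArg ω (ρ.G_anticomm_apply 0 0 x)
  have h0 : cocycle c 0 0 = 0 := by simp [cocycle]
  rw [map_add, hω.apply_G_zero hΩ hcyc, h0, zero_smul, add_zero, add_zero, map_smul] at h
  simpa using h.symm

end IsVacuumFunctional

/-- The sign operator of the grading serves to enlarge an arbitrary invariant subspace to a graded
one. -/
theorem exists_parityOperator (ρ : NSRepresentation c V) : ∃ P : Module.End ℂ V,
    (∀ x, P (P x) = x) ∧ (∀ m x, P (ρ.L m x) = ρ.L m (P x)) ∧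
    (∀ k x, P (ρ.G k x) = -ρ.G k (P x)) ∧ (∀ x, x + P x ∈ ρ.parity 0) ∧
    ∀ x, x - P x ∈ ρ.parity 1 := by
  have hc : IsCompl (ρ.parity 0) (ρ.parity 1) :=
    (DirectSum.isInternal_submodule_iff_isCompl ρ.parity (i := 0) (j := 1) (by decide)
      (by ext i; revert i; simp; decide)).1 ρ.isInternal
  have hdec (x : V) : ∃ y ∈ ρ.parity 0, ∃ z ∈ ρ.parity 1, y + z = x :=
    Submodule.mem_sup.1 (hc.sup_eq_top ▸ Submodule.mem_top)
  obtain ⟨P, h0, h1⟩ : ∃ P : Module.End ℂ V, (∀ y ∈ ρ.parity 0, P y = y) ∧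
      ∀ z ∈ ρ.parity 1, P z = -z :=
    ⟨LinearMap.ofIsCompl hc (ρ.parity 0).subtype (-(ρ.parity 1).subtype),
      fun y hy => LinearMap.ofIsCompl_apply_left hc ⟨y, hy⟩,
      fun z hz => LinearMap.ofIsCompl_apply_right hc ⟨z, hz⟩⟩
  refine ⟨P, fun x => ?_, fun m x => ?_, fun k x => ?_, fun x => ?_, fun x => ?_⟩ <;>
    obtain ⟨y, hy, z, hz, rfl⟩ := hdec x
  · simp [h0 y hy, h1 z hz]
  · simp [h0 y hy, h1 z hz, h0 _ (ρ.L_even m 0 y hy), h1 _ (ρ.L_even m 1 z hz)]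
  · have h2 := ρ.G_odd k 0 y hy
    have h3 := ρ.G_odd k 1 z hz
    rw [zero_add] at h2
    rw [show (1 + 1 : ZMod 2) = 0 by decide] at h3
    simp only [map_add, h0 y hy, h1 z hz, h1 _ h2, h0 _ h3, map_neg]
    abel
  · rw [map_add, h0 y hy, h1 z hz, show y + z + (y + -z) = (2 : ℂ) • y by module]
    exact Submodule.smul_mem _ _ hy
  · rw [map_add, h0 y hy, h1 z hz, show y + z - (y + -z) = (2 : ℂ) • z by module]
    exact Submodule.smul_mem _ _ hz

/-- In an irreducible representation an invariant subspace, graded or not, on which the vacuum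
functional vanishes, is zero. -/
theorem IsVacuumFunctional.eq_bot {ω : V →ₗ[ℂ] ℂ} (hω : ρ.IsVacuumFunctional Ω ω)
    (hirr : ρ.IsIrreducible) {W : Submodule ℂ V} (hW : ρ.IsInvariant W)
    (hker : W ≤ LinearMap.ker ω) : W = ⊥ := by
  obtain ⟨P, hPP, hPL, hPG, hP0, hP1⟩ := ρ.exists_parityOperator
  have hPmem : ∀ x ∈ W ⊔ W.map P, P x ∈ W ⊔ W.map P := by
    intro x hx
    obtain ⟨y, hy, _, ⟨z, hz, rfl⟩, rfl⟩ := Submodule.mem_sup.1 hx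
    rw [map_add, hPP, add_comm]
    exact Submodule.add_mem_sup hz (Submodule.mem_map_of_mem hy)
  have hinv : ρ.IsInvariant (W ⊔ W.map P) := by
    refine ⟨fun m x hx => ?_, fun k x hx => ?_⟩ <;>
      obtain ⟨y, hy, _, ⟨z, hz, rfl⟩, rfl⟩ := Submodule.mem_sup.1 hx
    · rw [map_add, ← hPL]
      exact Submodule.add_mem_sup (hW.1 m y hy) (Submodule.mem_map_of_mem (hW.1 m z hz))
    · rw [map_add, ← neg_neg (ρ.G k (P z)), ← hPG]
      exact Submodule.add_mem_sup (hW.2 k y hy)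
        (Submodule.neg_mem _ (Submodule.mem_map_of_mem (hW.2 k z hz)))
  have hgr : ρ.IsGraded (W ⊔ W.map P) := by
    refine le_antisymm (fun x hx => ?_) (sup_le inf_le_left inf_le_left)
    rw [show x = (1 / 2 : ℂ) • (x + P x) + (1 / 2 : ℂ) • (x - P x) by module]
    exact Submodule.add_mem_sup
      (Submodule.smul_mem _ _ ⟨Submodule.add_mem _ hx (hPmem x hx), hP0 x⟩)
      (Submodule.smul_mem _ _ ⟨Submodule.sub_mem _ hx (hPmem x hx), hP1 x⟩)
  rcases hirr.2 _ hinv hgr with h | h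
  · exact le_bot_iff.1 (h ▸ le_sup_left)
  -- The sum cannot be everything: `P` commutes with `L 0`, so `ω` also vanishes on the image of
  -- `W`, but `ω Ω = 1`.
  · have hle : W ⊔ W.map P ≤ LinearMap.ker ω := by
      refine sup_le hker ?_
      rintro _ ⟨z, hz, rfl⟩
      exact hω.apply_of_commute P (hPL 0) z (hker hz)
    have : ω Ω = 0 := hle (h ▸ Submodule.mem_top)
    rw [hω.apply_vac] at this
    exact absurd this one_ne_zero

/-- The vacuum vector of an irreducible representation is annihilated by `G_{-1/2}`. -/
theorem IsVacuumFunctional.G_neg_one_vac {ω : V →ₗ[ℂ] ℂ} (hω : ρ.IsVacuumFunctional Ω ω)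
    (hirr : ρ.IsIrreducible) (hΩ : ρ.IsLowestWeightVector 0 Ω) : ρ.G (-1) Ω = 0 := by
  -- The vector `G (-1) Ω` is again annihilated by all `G k` with `k ≥ 0`, so lowering operators
  -- alone generate an invariant subspace from it, and `ω` vanishes there.
  have hinv : ρ.IsInvariant (lowClosure ρ.G (ρ.G (-1) Ω)) := by
    refine isInvariant_lowClosure (fun k hk => ?_) ⟨_, G_eigenvector hΩ.2.1 (-1)⟩
    have h := ρ.G_anticomm_apply k (-1) Ω
    have hL : ρ.L k Ω = 0 := by
      rcases hk.eq_or_lt with rfl | hk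
      · rw [hΩ.2.1, zero_smul]
      · exact hΩ.2.2.1 k hk
    have h0 : cocycle c k (-1) = 0 := by
      rw [cocycle]
      split_ifs with h
      · obtain rfl : k = 0 := by omega
        norm_num
      · rfl
    rwa [hΩ.2.2.2 k hk, map_zero, add_zero, h0, zero_smul, add_zero,
      show k + -1 + 1 = k by ring, hL, smul_zero] at h
  have := hω.eq_bot hirr hinv (lowClosure_le (hω.apply_G_neg _ (by omega) _)
    fun k hk x _ _ => hω.apply_G_neg k hk x)
  exact (Submodule.mem_bot ℂ).1 (this ▸ mem_lowClosure_self)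

end NSRepresentation

/-! ### The intertwining map into the Fock space. -/

namespace NSRepresentation

open NeveuSchwarz FreeFock
open scoped ComplexConjugate InnerProductSpace

noncomputable section

variable {c : ℂ} {V : Type*} [AddCommGroup V] [Module ℂ V] {ρ : NSRepresentation c V} {Ω : V}

/-- The operator `G_{k + 1/2} + G_{k + 3/2}`. -/
def HV (ρ : NSRepresentation c V) (k : ℤ) : Module.End ℂ V := ρ.G k + ρ.G (k + 1)

/-- The operator `L_n + 2 L_{n + 1} + L_{n + 2}`. -/
def TV (ρ : NSRepresentation c V) (n : ℤ) : Module.End ℂ V :=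
  ρ.L n + (2 : ℂ) • ρ.L (n + 1) + ρ.L (n + 2)

theorem HV_apply (k : ℤ) (x : V) : ρ.HV k x = ρ.G k x + ρ.G (k + 1) x := rfl

theorem TV_apply (n : ℤ) (x : V) :
    ρ.TV n x = ρ.L n x + (2 : ℂ) • ρ.L (n + 1) x + ρ.L (n + 2) x := rfl

theorem HV_anticomm (ρ : NSRepresentation c V) (j k : ℤ) :
    ρ.HV j * ρ.HV k + ρ.HV k * ρ.HV j = (2 : ℂ) • ρ.TV (j + k + 1) + cocycle' c j k • 1 :=
  shifted_anticomm ρ.G_anticomm j k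

theorem TV_comm_HV (ρ : NSRepresentation c V) (n k : ℤ) :
    ρ.TV n * ρ.HV k - ρ.HV k * ρ.TV n = ((n : ℂ) / 2 - (k + 1 / 2)) •
      (ρ.HV (n + k) + (2 : ℂ) • ρ.HV (n + k + 1) + ρ.HV (n + k + 2)) := by
  simp only [HV]
  rw [show n + k + 1 + 1 = n + k + 2 by ring, show n + k + 2 + 1 = n + k + 3 by ring]
  exact shifted_comm ρ.L_comm_G n k

theorem TV_eq (ρ : NSRepresentation c V) (n : ℤ) (x : V) :
    ρ.TV n x = (1 / 2 : ℂ) • (ρ.HV (-1) (ρ.HV n x) + ρ.HV n (ρ.HV (-1) x)) := by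
  have h := congrArg (fun f : Module.End ℂ V => f x) (ρ.HV_anticomm (-1) n)
  simp only [LinearMap.add_apply, Module.End.mul_apply, LinearMap.smul_apply, cocycle'_neg_one,
    zero_smul, add_zero] at h
  rw [h, show -1 + n + 1 = n by ring]
  module

/-- A lowest weight vector of weight `0` that is also annihilated by `G_{-1/2}`. -/
structure IsVacuum (ρ : NSRepresentation c V) (Ω : V) : Prop where
  isLowestWeightVector : ρ.IsLowestWeightVector 0 Ω
  G_neg_one : ρ.G (-1) Ω = 0

theorem IsVacuum.G_eq_zero (hΩ : ρ.IsVacuum Ω) {k : ℤ} (hk : -1 ≤ k) : ρ.G k Ω = 0 := by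
  rcases hk.eq_or_lt with rfl | hk
  · exact hΩ.G_neg_one
  · exact hΩ.isLowestWeightVector.2.2.2 k (by omega)

theorem IsVacuum.L_eq_zero (hΩ : ρ.IsVacuum Ω) {n : ℤ} (hn : -1 ≤ n) : ρ.L n Ω = 0 := by
  rcases lt_trichotomy n 0 with hn' | rfl | hn'
  · obtain rfl : n = -1 := by omega
    have h := ρ.G_anticomm_apply (-1) (-1) Ω
    simp only [hΩ.G_neg_one, map_zero, cocycle] at h
    rw [if_neg (by norm_num), zero_smul, add_zero, add_zero] at h
    exact (smul_eq_zero.1 h.symm).resolve_left two_ne_zero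
  · rw [hΩ.isLowestWeightVector.2.1, zero_smul]
  · exact hΩ.isLowestWeightVector.2.2.1 n hn'

theorem IsVacuum.HV_eq_zero (hΩ : ρ.IsVacuum Ω) {k : ℤ} (hk : -1 ≤ k) : ρ.HV k Ω = 0 := by
  rw [HV_apply, hΩ.G_eq_zero hk, hΩ.G_eq_zero (by omega), add_zero]

section Correspondence

/-- The operator `G_{k + 1/2} + G_{k + 3/2}` on the direct sum of `V` and the Fock space. -/
def HP (ρ : NSRepresentation c V) (κ : ℝ) (k : ℤ) : Module.End ℂ (V × Fock) :=
  (ρ.HV k).prodMap (H κ k)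

/-- The operator `L_n + 2 L_{n + 1} + L_{n + 2}` on the direct sum of `V` and the Fock space. -/
def TP (ρ : NSRepresentation c V) (κ : ℝ) (n : ℤ) : Module.End ℂ (V × Fock) :=
  (ρ.TV n).prodMap (T κ n)

/-- The subspace generated from the pair of the vacuum vectors. -/
def graph (ρ : NSRepresentation c V) (κ : ℝ) (Ω : V) : Submodule ℂ (V × Fock) :=
  lowClosure (ρ.HP κ) (Ω, vac)

variable {κ : ℝ}

/-- Both components obey the same relations, with the same central term by the choice of `κ`, so the
general invariance of `lowClosure` applies to the direct sum. -/
theorem graph_closed (hκ : c = 3 / 2 + 3 * (κ : ℂ) ^ 2) (hΩ : ρ.IsVacuum Ω) (k : ℤ)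
    {p : V × Fock} (hp : p ∈ ρ.graph κ Ω) : ρ.HP κ k p ∈ ρ.graph κ Ω := by
  have hAA (j k : ℤ) : ρ.HP κ j * ρ.HP κ k + ρ.HP κ k * ρ.HP κ j =
      (2 : ℂ) • ρ.TP κ (j + k + 1) + cocycle' c j k • 1 := by
    refine LinearMap.ext fun p => Prod.ext ?_ ?_
    · exact congrArg (fun f : Module.End ℂ V => f p.1) (ρ.HV_anticomm j k)
    · subst hκ
      exact congrArg (fun f : Module.End ℂ Fock => f p.2) (H_anticomm_H κ j k)
  have hBA (n k : ℤ) : ρ.TP κ n * ρ.HP κ k - ρ.HP κ k * ρ.TP κ n = ((n : ℂ) / 2 - (k + 1 / 2)) •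
      (ρ.HP κ (n + k) + (2 : ℂ) • ρ.HP κ (n + k + 1) + ρ.HP κ (n + k + 2)) := by
    refine LinearMap.ext fun p => Prod.ext ?_ ?_
    · exact congrArg (fun f : Module.End ℂ V => f p.1) (ρ.TV_comm_HV n k)
    · exact congrArg (fun f : Module.End ℂ Fock => f p.2) (T_comm_H κ n k)
  have hA (k : ℤ) (hk : -1 ≤ k) : ρ.HP κ k (Ω, vac) = 0 :=
    Prod.ext (hΩ.HV_eq_zero hk) (H_vac κ hk)
  refine (lowClosure_invariant hAA (fun n k x => ?_) (fun k hk => hA k (by omega)) ⟨0, ?_⟩ hp).1 k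
  · rw [hBA]
    exact Submodule.smul_mem _ _ (Submodule.add_mem _ (Submodule.add_mem _
      (Submodule.subset_span ⟨_, rfl⟩) (Submodule.smul_mem _ _ (Submodule.subset_span ⟨_, rfl⟩)))
      (Submodule.subset_span ⟨_, rfl⟩))
  · have h := congrArg (fun f : Module.End ℂ (V × Fock) => f (Ω, vac)) (hAA 0 (-1))
    simp only [LinearMap.add_apply, Module.End.mul_apply, LinearMap.smul_apply,
      hA 0 (by omega), hA (-1) le_rfl, map_zero, cocycle'_zero_neg_one, zero_smul, add_zero] at h
    rw [zero_smul]
    exact (smul_eq_zero.1 h.symm).resolve_left two_ne_zero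

/-- Both functionals vanish on images of the lowering operators. At `k = -1` the combined mode
contains `G 0`, hence the need for `apply_G_zero`. -/
theorem graph_vacuum_expectation {ω : V →ₗ[ℂ] ℂ} (hω : ρ.IsVacuumFunctional Ω ω)
    (hΩ : ρ.IsVacuum Ω) (hcyc : ρ.IsCyclicVector Ω) {p : V × Fock} (hp : p ∈ ρ.graph κ Ω) :
    ⟪vac, p.2⟫_ℂ = ω p.1 := by
  suffices h : ρ.graph κ Ω ≤ LinearMap.ker
      (innerₛₗ ℂ vac ∘ₗ LinearMap.snd ℂ V Fock - ω ∘ₗ LinearMap.fst ℂ V Fock) from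
    sub_eq_zero.1 (h hp)
  have hG : ∀ k ≤ 0, ∀ x, ω (ρ.G k x) = 0 := by
    intro k hk x
    rcases hk.eq_or_lt with rfl | hk
    · exact hω.apply_G_zero hΩ.isLowestWeightVector hcyc x
    · exact hω.apply_G_neg k hk x
  refine lowClosure_le ?_ fun k hk p _ _ => ?_
  · rw [LinearMap.mem_ker]
    change ⟪vac, vac⟫_ℂ - ω Ω = 0
    rw [inner_vac_vac, hω.apply_vac, sub_self]
  · rw [LinearMap.mem_ker]
    change ⟪vac, H κ k p.2⟫_ℂ - ω (ρ.G k p.1 + ρ.G (k + 1) p.1) = 0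
    rw [map_add, hG k hk.le, hG (k + 1) (by omega), show k = -(-k - 2) - 2 by ring, ← inner_H,
      H_vac κ (by omega), inner_zero_left, add_zero, sub_zero]

/-- Single modes applied to `Ω` are recovered by telescoping, since those of index at least `-1`
vanish; on other vectors the (anti)commutators carry this along. -/
theorem graph_surjective (hκ : c = 3 / 2 + 3 * (κ : ℂ) ^ 2) (hΩ : ρ.IsVacuum Ω)
    (hcyc : ρ.IsCyclicVector Ω) : (ρ.graph κ Ω).map (LinearMap.fst ℂ V Fock) = ⊤ := by
  set S := (ρ.graph κ Ω).map (LinearMap.fst ℂ V Fock) with hS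
  have hΩS : Ω ∈ S := ⟨(Ω, vac), mem_lowClosure_self, rfl⟩
  have hH (k : ℤ) {x : V} (hx : x ∈ S) : ρ.HV k x ∈ S := by
    obtain ⟨p, hp, rfl⟩ := hx
    exact ⟨_, graph_closed hκ hΩ k hp, rfl⟩
  have hT (n : ℤ) {x : V} (hx : x ∈ S) : ρ.TV n x ∈ S := by
    rw [TV_eq]
    exact S.smul_mem _ (S.add_mem (hH _ (hH _ hx)) (hH _ (hH _ hx)))
  suffices h : ρ.graph κ Ω ≤ (stabilized ρ.G ρ.L S).comap (LinearMap.fst ℂ V Fock) by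
    refine hcyc S ⟨?_, ?_⟩ hΩS
    · rintro m _ ⟨p, hp, rfl⟩
      exact (mem_stabilized.1 (h hp)).2 m
    · rintro k _ ⟨p, hp, rfl⟩
      exact (mem_stabilized.1 (h hp)).1 k
  refine lowClosure_le ?_ fun k _ p hp h => ?_
  · have hG (n : ℕ) : ρ.G (-1 - n) Ω ∈ S := by
      induction n with
      | zero => rw [hΩ.G_eq_zero (by simp)]; exact S.zero_mem
      | succ n ih =>
        have := hH (-1 - (n + 1)) hΩS
        rw [HV_apply, show (-1 - (n + 1) + 1 : ℤ) = -1 - n by ring] at this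
        push_cast
        exact (S.add_mem_iff_left ih).1 this
    have hL (n : ℕ) : ρ.L (-n) Ω ∈ S ∧ ρ.L (-(n + 1)) Ω ∈ S := by
      induction n with
      | zero =>
        rw [hΩ.L_eq_zero (by simp), hΩ.L_eq_zero (by simp)]
        exact ⟨S.zero_mem, S.zero_mem⟩
      | succ n ih =>
        push_cast
        refine ⟨ih.2, ?_⟩
        have := hT (-(n + 1 + 1)) hΩS
        rw [TV_apply, show (-(n + 1 + 1) + 1 : ℤ) = -(n + 1) by ring,
          show (-(n + 1 + 1) + 2 : ℤ) = -n by ring] at this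
        exact (S.add_mem_iff_left (S.smul_mem _ ih.2)).1 ((S.add_mem_iff_left ih.1).1 this)
    refine mem_stabilized.2 ⟨fun k => ?_, fun n => ?_⟩
    · change ρ.G k Ω ∈ S
      rcases le_or_gt (-1) k with hk | hk
      · rw [hΩ.G_eq_zero hk]; exact S.zero_mem
      · have := hG (-1 - k).toNat
        rwa [Int.toNat_of_nonneg (by omega), sub_sub_cancel] at this
    · change ρ.L n Ω ∈ S
      rcases le_or_gt (-1) n with hn | hn
      · rw [hΩ.L_eq_zero hn]; exact S.zero_mem
      · have := (hL (-n).toNat).1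
        rwa [Int.toNat_of_nonneg (by omega), neg_neg] at this
  · obtain ⟨h1, h2⟩ := mem_stabilized.1 h
    obtain ⟨x, y⟩ := p
    replace hp : x ∈ S := ⟨_, hp, rfl⟩
    refine mem_stabilized.2 ⟨fun j => ?_, fun n => ?_⟩
    · change ρ.G j (ρ.G k x + ρ.G (k + 1) x) ∈ S
      have e1 := ρ.G_anticomm_apply j k x
      have e2 := ρ.G_anticomm_apply j (k + 1) x
      have e3 := hH k (h1 j)
      change ρ.G k (ρ.G j x) + ρ.G (k + 1) (ρ.G j x) ∈ S at e3
      rw [map_add, ← S.add_mem_iff_left e3, add_add_add_comm, e1, e2]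
      exact S.add_mem (S.add_mem (S.smul_mem _ (h2 _)) (S.smul_mem _ hp))
        (S.add_mem (S.smul_mem _ (h2 _)) (S.smul_mem _ hp))
    · change ρ.L n (ρ.G k x + ρ.G (k + 1) x) ∈ S
      have e3 := hH k (h2 n)
      change ρ.G k (ρ.L n x) + ρ.G (k + 1) (ρ.L n x) ∈ S at e3
      rw [map_add, sub_eq_iff_eq_add.1 (ρ.L_comm_G_apply n k x),
        sub_eq_iff_eq_add.1 (ρ.L_comm_G_apply n (k + 1) x), add_add_add_comm]
      exact S.add_mem (S.add_mem (S.smul_mem _ (h1 _)) (S.smul_mem _ (h1 _))) e3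

/-- Combined modes move from `q` to `p` by adjunction, and on `p` they act compatibly on both
components; at the vacuum the functional is `ω`. -/
theorem graph_inner_eq {ω : V →ₗ[ℂ] ℂ} (hκ : c = 3 / 2 + 3 * (κ : ℂ) ^ 2)
    (hω : ρ.IsVacuumFunctional Ω ω) (hΩ : ρ.IsVacuum Ω) (hcyc : ρ.IsCyclicVector Ω)
    {q : V × Fock} (hq : q ∈ ρ.graph κ Ω) :
    ∃ l : V →ₗ[ℂ] ℂ, ∀ p ∈ ρ.graph κ Ω, ⟪q.2, p.2⟫_ℂ = l p.1 := by
  let S : Submodule ℂ (V × Fock) :=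
    { carrier := {q | ∃ l : V →ₗ[ℂ] ℂ, ∀ p ∈ ρ.graph κ Ω, ⟪q.2, p.2⟫_ℂ = l p.1}
      add_mem' := by
        rintro q r ⟨l, hl⟩ ⟨m, hm⟩
        exact ⟨l + m, fun p hp => by simp [hl p hp, hm p hp]⟩
      zero_mem' := ⟨0, fun p _ => by simp⟩
      smul_mem' := by
        rintro z q ⟨l, hl⟩
        exact ⟨conj z • l, fun p hp => by simp [hl p hp, mul_comm]⟩ }
  suffices h : ρ.graph κ Ω ≤ S from h hq
  refine lowClosure_le ⟨ω, fun p hp => graph_vacuum_expectation hω hΩ hcyc hp⟩ ?_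
  rintro k - q - ⟨l, hl⟩
  refine ⟨l ∘ₗ ρ.HV (-k - 2), fun p hp => ?_⟩
  exact (inner_H κ k q.2 p.2).trans (hl _ (graph_closed hκ hΩ (-k - 2) hp))

/-- The graph of the vacuum vectors is the graph of an intertwining map to the Fock space. -/
theorem exists_intertwiner {ω : V →ₗ[ℂ] ℂ} (hκ : c = 3 / 2 + 3 * (κ : ℂ) ^ 2)
    (hω : ρ.IsVacuumFunctional Ω ω) (hΩ : ρ.IsVacuum Ω) (hcyc : ρ.IsCyclicVector Ω) :
    ∃ Φ : V →ₗ[ℂ] Fock, Φ Ω = vac ∧ (∀ k x, Φ (ρ.HV k x) = H κ k (Φ x)) ∧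
      ∀ x, ⟪vac, Φ x⟫_ℂ = ω x := by
  have hinj {x : V} {y y' : Fock} (hy : (x, y) ∈ ρ.graph κ Ω) (hy' : (x, y') ∈ ρ.graph κ Ω) :
      y = y' := by
    have h := Submodule.sub_mem _ hy hy'
    -- With `q = p = (0, y - y')` the squared norm of `y - y'` is `l 0 = 0`.
    obtain ⟨l, hl⟩ := graph_inner_eq hκ hω hΩ hcyc h
    have h2 := hl _ h
    simp only [Prod.mk_sub_mk, sub_self, map_zero] at h2
    exact sub_eq_zero.1 (inner_self_eq_zero.1 h2)
  let f : ρ.graph κ Ω →ₗ[ℂ] V := LinearMap.fst ℂ V Fock ∘ₗ (ρ.graph κ Ω).subtype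
  have hf : Function.Bijective f := by
    constructor
    · rintro ⟨⟨x, y⟩, hp⟩ ⟨⟨x', y'⟩, hp'⟩ h
      obtain rfl : x = x' := h
      obtain rfl := hinj hp hp'
      rfl
    · intro x
      obtain ⟨p, hp, rfl⟩ : x ∈ (ρ.graph κ Ω).map (LinearMap.fst ℂ V Fock) :=
        graph_surjective hκ hΩ hcyc ▸ Submodule.mem_top
      exact ⟨⟨p, hp⟩, rfl⟩
  let e := LinearEquiv.ofBijective f hf
  let Φ : V →ₗ[ℂ] Fock :=
    LinearMap.snd ℂ V Fock ∘ₗ (ρ.graph κ Ω).subtype ∘ₗ e.symm.toLinearMap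
  have hΦ (x : V) : (x, Φ x) ∈ ρ.graph κ Ω := by
    have h1 : (e.symm x).1.1 = x := e.apply_symm_apply x
    have h2 : (x, Φ x) = (e.symm x).1 := Prod.ext h1.symm rfl
    rw [h2]
    exact (e.symm x).2
  refine ⟨Φ, hinj (hΦ Ω) mem_lowClosure_self, fun k x => ?_, fun x => ?_⟩
  · exact hinj (hΦ _) (graph_closed hκ hΩ k (hΦ x))
  · exact graph_vacuum_expectation hω hΩ hcyc (hΦ x)

end Correspondence

end

end NSRepresentation

/-! ### Adjoint relations of the pulled back form, and unitarity. -/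

namespace NSRepresentation

open NeveuSchwarz FreeFock
open scoped ComplexConjugate InnerProductSpace

variable {V : Type*} [AddCommGroup V] [Module ℂ V]

theorem conj_cocycle (c : ℝ) (j k : ℤ) : conj (cocycle (c : ℂ) j k) = cocycle c j k := by
  rw [cocycle]
  split_ifs
  · simp [map_ofNat]
  · exact map_zero _

theorem cocycle_neg (c : ℂ) (j k : ℤ) : cocycle c (-j - 1) (-k - 1) = cocycle c j k := by
  rw [cocycle, cocycle]
  refine if_congr (by omega) ?_ rfl
  push_cast
  ring

section Adjoint

variable {c : ℝ} {ρ : NSRepresentation (c : ℂ) V} {Ω : V} {κ : ℝ} {Φ : V →ₗ[ℂ] Fock}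

theorem inner_HV (hΦ : ∀ k x, Φ (ρ.HV k x) = H κ k (Φ x)) (k : ℤ) (x y : V) :
    ⟪Φ (ρ.HV k x), Φ y⟫_ℂ = ⟪Φ x, Φ (ρ.HV (-k - 2) y)⟫_ℂ := by
  rw [hΦ, hΦ, inner_H]

theorem inner_TV (hΦ : ∀ k x, Φ (ρ.HV k x) = H κ k (Φ x)) (n : ℤ) (x y : V) :
    ⟪Φ (ρ.TV n x), Φ y⟫_ℂ = ⟪Φ x, Φ (ρ.TV (-n - 2) y)⟫_ℂ := by
  rw [TV_eq, TV_eq, map_smul, map_smul, map_add, map_add, inner_smul_left, inner_smul_right,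
    inner_add_left, inner_add_right, inner_HV hΦ, inner_HV hΦ, inner_HV hΦ, inner_HV hΦ,
    show (-(-1) - 2 : ℤ) = -1 by norm_num, add_comm, map_div₀, map_one, Complex.conj_ofNat]

/-- For `k ≤ 0` both sides vanish; the relation for `G k + G (k + 1)` then carries the identity from
`k` to `k + 1`. -/
theorem inner_G_vac {ω : V →ₗ[ℂ] ℂ} (hω : ρ.IsVacuumFunctional Ω ω) (hΩ : ρ.IsVacuum Ω)
    (hcyc : ρ.IsCyclicVector Ω) (hvac : Φ Ω = vac) (hΦ : ∀ k x, Φ (ρ.HV k x) = H κ k (Φ x))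
    (hΦω : ∀ x, ⟪vac, Φ x⟫_ℂ = ω x) (k : ℤ) (x : V) :
    ⟪Φ (ρ.G k x), Φ Ω⟫_ℂ = ⟪Φ x, Φ (ρ.G (-k - 1) Ω)⟫_ℂ := by
  have hneg (k : ℤ) (hk : k ≤ 0) :
      ⟪Φ (ρ.G k x), Φ Ω⟫_ℂ = ⟪Φ x, Φ (ρ.G (-k - 1) Ω)⟫_ℂ := by
    rw [hΩ.G_eq_zero (show -1 ≤ -k - 1 by omega), map_zero, inner_zero_right, hvac,
      ← inner_conj_symm, hΦω, map_eq_zero]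
    rcases hk.eq_or_lt with rfl | hk
    · exact hω.apply_G_zero hΩ.isLowestWeightVector hcyc x
    · exact hω.apply_G_neg k hk x
  rcases le_or_gt k 0 with hk | hk
  · exact hneg k hk
  · induction k, hk.le using Int.leInduction with
    | base => exact hneg 0 le_rfl
    | succ k hk0 ih =>
      have ih' : ⟪Φ (ρ.G k x), Φ Ω⟫_ℂ = ⟪Φ x, Φ (ρ.G (-k - 1) Ω)⟫_ℂ := by
        rcases hk0.eq_or_lt with rfl | h
        · exact hneg 0 le_rfl
        · exact ih h
      have h := inner_HV hΦ k x Ω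
      simp only [HV_apply, map_add, inner_add_left, inner_add_right] at h
      rw [show -k - 2 + 1 = -k - 1 by ring] at h
      rw [show -(k + 1) - 1 = -k - 2 by ring]
      linear_combination h - ih'

/-- Both sides vanish up to `m = 1`. The relation for `TV` involves three consecutive modes, so two
consecutive cases are carried along. -/
theorem inner_L_vac {ω : V →ₗ[ℂ] ℂ} (hω : ρ.IsVacuumFunctional Ω ω) (hΩ : ρ.IsVacuum Ω)
    (hcyc : ρ.IsCyclicVector Ω) (hvac : Φ Ω = vac) (hΦ : ∀ k x, Φ (ρ.HV k x) = H κ k (Φ x))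
    (hΦω : ∀ x, ⟪vac, Φ x⟫_ℂ = ω x) (m : ℤ) (x : V) :
    ⟪Φ (ρ.L m x), Φ Ω⟫_ℂ = ⟪Φ x, Φ (ρ.L (-m) Ω)⟫_ℂ := by
  have hneg (m : ℤ) (hm : m ≤ 1) : ⟪Φ (ρ.L m x), Φ Ω⟫_ℂ = ⟪Φ x, Φ (ρ.L (-m) Ω)⟫_ℂ := by
    rw [hΩ.L_eq_zero (show -1 ≤ -m by omega), map_zero, inner_zero_right, hvac,
      ← inner_conj_symm, hΦω, map_eq_zero]
    rcases hm.eq_or_lt with rfl | hm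
    · exact hω.apply_L_one hΩ.isLowestWeightVector hcyc x
    · exact hω.apply_L_nonpos (by omega) x
  have hpos (n : ℕ) : ⟪Φ (ρ.L n x), Φ Ω⟫_ℂ = ⟪Φ x, Φ (ρ.L (-n) Ω)⟫_ℂ ∧
      ⟪Φ (ρ.L (n + 1) x), Φ Ω⟫_ℂ = ⟪Φ x, Φ (ρ.L (-(n + 1)) Ω)⟫_ℂ := by
    induction n with
    | zero => exact ⟨hneg 0 (by norm_num), hneg 1 le_rfl⟩
    | succ n ih =>
      push_cast
      refine ⟨ih.2, ?_⟩
      have h := inner_TV hΦ n x Ω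
      simp only [TV_apply, map_add, map_smul, inner_add_left, inner_add_right, inner_smul_left,
        inner_smul_right, Complex.conj_ofNat] at h
      rw [show (-n - 2 + 1 : ℤ) = -(n + 1) by ring, show (-n - 2 + 2 : ℤ) = -n by ring] at h
      rw [show (n + 1 + 1 : ℤ) = n + 2 by ring, show (-(n + 2) : ℤ) = -n - 2 by ring]
      linear_combination h - ih.1 - 2 * ih.2
  rcases le_or_gt m 1 with hm | hm
  · exact hneg m hm
  · have := (hpos m.toNat).1
    rwa [Int.toNat_of_nonneg (by omega)] at this

/-- Induction on `y` from `Ω` uses the combined modes, whose adjoints are already known: moving a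
single mode past `HV k` leaves brackets covered by the induction hypothesis. -/
theorem inner_G_and_L {ω : V →ₗ[ℂ] ℂ} (hκ : (c : ℂ) = 3 / 2 + 3 * (κ : ℂ) ^ 2)
    (hω : ρ.IsVacuumFunctional Ω ω) (hΩ : ρ.IsVacuum Ω)
    (hcyc : ρ.IsCyclicVector Ω) (hvac : Φ Ω = vac) (hΦ : ∀ k x, Φ (ρ.HV k x) = H κ k (Φ x))
    (hΦω : ∀ x, ⟪vac, Φ x⟫_ℂ = ω x) (y : V) :
    (∀ k x, ⟪Φ (ρ.G k x), Φ y⟫_ℂ = ⟪Φ x, Φ (ρ.G (-k - 1) y)⟫_ℂ) ∧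
      ∀ m x, ⟪Φ (ρ.L m x), Φ y⟫_ℂ = ⟪Φ x, Φ (ρ.L (-m) y)⟫_ℂ := by
  let Y : Submodule ℂ V :=
    { carrier := {y | (∀ k x, ⟪Φ (ρ.G k x), Φ y⟫_ℂ = ⟪Φ x, Φ (ρ.G (-k - 1) y)⟫_ℂ) ∧
        ∀ m x, ⟪Φ (ρ.L m x), Φ y⟫_ℂ = ⟪Φ x, Φ (ρ.L (-m) y)⟫_ℂ}
      add_mem' := by
        rintro y z ⟨h1, h2⟩ ⟨h3, h4⟩
        constructor <;> intros <;> simp only [map_add, inner_add_right, h1, h2, h3, h4]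
      zero_mem' := by simp
      smul_mem' := by
        rintro t y ⟨h1, h2⟩
        constructor <;> intros <;> simp only [map_smul, inner_smul_right, h1, h2] }
  suffices h : ρ.graph κ Ω ≤ Y.comap (LinearMap.fst ℂ V Fock) by
    obtain ⟨p, hp, rfl⟩ : y ∈ (ρ.graph κ Ω).map (LinearMap.fst ℂ V Fock) :=
      graph_surjective hκ hΩ hcyc ▸ Submodule.mem_top
    exact h hp
  refine lowClosure_le ⟨inner_G_vac hω hΩ hcyc hvac hΦ hΦω,
    inner_L_vac hω hΩ hcyc hvac hΦ hΦω⟩ ?_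
  rintro k - ⟨y, v⟩ - ⟨h1, h2⟩
  change (∀ k x, ⟪Φ (ρ.G k x), Φ y⟫_ℂ = ⟪Φ x, Φ (ρ.G (-k - 1) y)⟫_ℂ) at h1
  change ∀ m x, ⟪Φ (ρ.L m x), Φ y⟫_ℂ = ⟪Φ x, Φ (ρ.L (-m) y)⟫_ℂ at h2
  have hH (x z : V) : ⟪Φ x, Φ (ρ.HV k z)⟫_ℂ = ⟪Φ (ρ.HV (-k - 2) x), Φ z⟫_ℂ := by
    rw [inner_HV hΦ, show -(-k - 2) - 2 = k by ring]
  refine ⟨fun j x => ?_, fun m x => ?_⟩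
  · change ⟪Φ (ρ.G j x), Φ (ρ.HV k y)⟫_ℂ = ⟪Φ x, Φ (ρ.G (-j - 1) (ρ.HV k y))⟫_ℂ
    have e0 := hH x (ρ.G (-j - 1) y)
    rw [← h1] at e0
    rw [hH]
    have l1 := congrArg (fun z => ⟪Φ z, Φ y⟫_ℂ) (ρ.G_anticomm_apply (-k - 2) j x)
    have l2 := congrArg (fun z => ⟪Φ z, Φ y⟫_ℂ) (ρ.G_anticomm_apply (-k - 1) j x)
    have r1 := congrArg (fun z => ⟪Φ x, Φ z⟫_ℂ) (ρ.G_anticomm_apply (-j - 1) k y)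
    have r2 := congrArg (fun z => ⟪Φ x, Φ z⟫_ℂ) (ρ.G_anticomm_apply (-j - 1) (k + 1) y)
    have c1 := cocycle_neg c j (-k - 1)
    have c2 := cocycle_neg c j (-k - 2)
    rw [show -(-k - 1) - 1 = k by ring] at c1
    rw [show -(-k - 2) - 1 = k + 1 by ring] at c2
    have s1 : cocycle (c : ℂ) (-k - 2) j = cocycle c j (-k - 2) := by
      rw [cocycle, cocycle, add_comm (-k - 2) j]
      split_ifs with h
      · obtain rfl : j = k + 1 := by omega
        push_cast
        ring
      · rfl
    have s2 : cocycle (c : ℂ) (-k - 1) j = cocycle c j (-k - 1) := by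
      rw [cocycle, cocycle, add_comm (-k - 1) j]
      split_ifs with h
      · obtain rfl : j = k := by omega
        push_cast
        ring
      · rfl
    simp only [map_add, map_smul, inner_add_left, inner_add_right, inner_smul_left,
      inner_smul_right, Complex.conj_ofNat, conj_cocycle, h2] at l1 l2 r1 r2
    simp only [HV_apply, map_add, inner_add_left, inner_add_right] at e0 ⊢
    rw [show -k - 2 + 1 = -k - 1 by ring] at e0 ⊢
    rw [show -(-k - 2 + j + 1) = -j - 1 + (k + 1) + 1 by ring] at l1
    rw [show -(-k - 1 + j + 1) = -j - 1 + k + 1 by ring] at l2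
    rw [c1, ← s2] at r1
    rw [c2, ← s1] at r2
    linear_combination l1 + l2 - r1 - r2 + e0
  · change ⟪Φ (ρ.L m x), Φ (ρ.HV k y)⟫_ℂ = ⟪Φ x, Φ (ρ.L (-m) (ρ.HV k y))⟫_ℂ
    have e0 := hH x (ρ.L (-m) y)
    rw [← h2] at e0
    rw [hH]
    have l1 := congrArg (fun z => ⟪Φ z, Φ y⟫_ℂ) (ρ.L_comm_G_apply m (-k - 2) x)
    have l2 := congrArg (fun z => ⟪Φ z, Φ y⟫_ℂ) (ρ.L_comm_G_apply m (-k - 1) x)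
    have r1 := congrArg (fun z => ⟪Φ x, Φ z⟫_ℂ) (ρ.L_comm_G_apply (-m) k y)
    have r2 := congrArg (fun z => ⟪Φ x, Φ z⟫_ℂ) (ρ.L_comm_G_apply (-m) (k + 1) y)
    rw [show m + (-k - 2) = -(k + 1 - m) - 1 by ring] at l1
    simp only [map_sub, map_smul, inner_sub_left, inner_sub_right, inner_smul_left,
      inner_smul_right, h1] at l1 l2 r1 r2
    rw [show -(-(k + 1 - m) - 1) - 1 = -m + (k + 1) by ring] at l1
    rw [show -(m + (-k - 1)) - 1 = -m + k by ring] at l2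
    simp only [map_add, map_div₀, map_one, map_intCast, Complex.conj_ofNat] at l1 l2
    push_cast at l1 l2 r1 r2
    simp only [HV_apply, map_add, inner_add_left, inner_add_right] at e0 ⊢
    rw [show -k - 2 + 1 = -k - 1 by ring] at e0 ⊢
    simp only [h1]
    linear_combination -e0 - l1 - l2 - r1 - r2

end Adjoint

/-- The irreducible representation of weight `0` is unitary if its central charge is that of a
deformed free field representation. -/
theorem isUnitary_of_eq {c : ℝ} {ρ : NSRepresentation (c : ℂ) V} {κ : ℝ}
    (hκ : (c : ℂ) = 3 / 2 + 3 * (κ : ℂ) ^ 2) (hirr : ρ.IsIrreducible) (hlw : ρ.IsLowestWeight 0) :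
    ρ.IsUnitary := by
  obtain ⟨Ω, hΩ', hcyc⟩ := hlw
  obtain ⟨ω, hω⟩ := exists_isVacuumFunctional hΩ' hcyc
  have hΩ : ρ.IsVacuum Ω := ⟨hΩ', hω.G_neg_one_vac hirr hΩ'⟩
  obtain ⟨Φ, hvac, hΦ, hΦω⟩ := exists_intertwiner hκ hω hΩ hcyc
  have hadj := inner_G_and_L hκ hω hΩ hcyc hvac hΦ hΦω
  -- The adjoint relations make the null space of the form invariant, and `ω` factors through `Φ`.
  have hker : LinearMap.ker Φ = ⊥ := by
    refine hω.eq_bot hirr ⟨fun m x hx => ?_, fun k x hx => ?_⟩ fun x hx => ?_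
    · rw [LinearMap.mem_ker] at hx ⊢
      rw [← inner_self_eq_zero (𝕜 := ℂ), (hadj _).2, hx, inner_zero_left]
    · rw [LinearMap.mem_ker] at hx ⊢
      rw [← inner_self_eq_zero (𝕜 := ℂ), (hadj _).1, hx, inner_zero_left]
    · rw [LinearMap.mem_ker] at hx ⊢
      rw [← hΦω, hx, inner_zero_right]
  refine ⟨{ inner := fun x y => ⟪Φ x, Φ y⟫_ℂ
            conj_inner_symm := fun x y => inner_conj_symm _ _
            re_inner_nonneg := fun x => inner_self_nonneg
            add_left := fun x y z => by rw [map_add, inner_add_left]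
            smul_left := fun x y r => by rw [map_smul, inner_smul_left]
            definite := fun x hx => ?_ }, fun m x y => (hadj y).2 m x, fun k x y => (hadj y).1 k x⟩
  have : x ∈ LinearMap.ker Φ := inner_self_eq_zero.1 hx
  rwa [hker, Submodule.mem_bot] at this

end NSRepresentation

theorem mainTheorem7 {V : Type*} [AddCommGroup V] [Module ℂ V] (c : ℝ) (hc : 3 / 2 ≤ c)
    (ρ : NSRepresentation (c : ℂ) V) (hirr : ρ.IsIrreducible) (hlw : ρ.IsLowestWeight 0) :
    ρ.IsUnitary := by
  -- This `κ` solves `c = 3/2 + 3κ²`; a real solution exists because `c ≥ 3/2`.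
  refine NSRepresentation.isUnitary_of_eq (κ := √((c - 3 / 2) / 3)) ?_ hirr hlw
  have h : √((c - 3 / 2) / 3) ^ 2 = (c - 3 / 2) / 3 := Real.sq_sqrt (by linarith)
  rw [← Complex.ofReal_pow, h]
  push_cast
  ring
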